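/- Let $n\in\mathbb N$, $\alpha,\beta>0$, $u_0\in L^2(\mathbb R^n)$, and let $u\in C([0,\infty);L^2(\mathbb R^n))$ be the solution (in the sense of tempered distributions) of the free Schrödinger equation $\partial_t u=i\Delta u$, $t>0$, with $u(0)=u_0$. Write $\widehat f(\xi)=(2\pi)^{-n/2}\int_{\mathbb R^n}e^{-ix\cdot\xi}f(x)\,dx$ for the (unitary) Fourier transform on $L^2(\mathbb R^n)$, let $\|\cdot\|_2$ be the $L^2(\mathbb R^n)$ norm, with value $\infty$ for functions not in $L^2$, and put, for $T>0$, $$\theta(t)=\frac{\beta(T-t)}{T(\alpha t+\beta)},\qquad \mu(t)=\frac{\beta}{\alpha t+\beta}.$$ Then for every $\nu\in\mathbb R^n$ the following inequalities hold in $[0,\infty]$, with the conventions $0\cdot\infty=0$ and $\infty^0=0^0=1$ (in particular, each left-hand side is finite whenever the corresponding right-hand side is). (i) For all $T>0$ and $0\le t\le T$, $$\Big\|e^{\frac{|x+2t\nu|^2}{(\alpha t+\beta)^2}}u(t)\Big\|_2\le \Big\|e^{\frac{|x|^2}{\beta^2}}u(0)\Big\|_2^{\theta(t)}\,\Big\|e^{\frac{|x+2T\nu|^2}{(\alpha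 T+\beta)^2}}u(T)\Big\|_2^{1-\theta(t)}.$$ (ii) For all $t\ge 0$, $$\Big\|e^{\frac{|x+2t\nu|^2}{(\alpha t+\beta)^2}}u(t)\Big\|_2\le \Big\|e^{\frac{|x|^2}{\beta^2}}u(0)\Big\|_2^{\mu(t)}\,\Big\|e^{\frac{4|\xi+\nu|^2}{\alpha^2}}\widehat u(0)\Big\|_2^{1-\mu(t)}.$$ -/

import Mathlib

open MeasureTheory Set
open scoped ENNReal SchwartzMap FourierTransform Laplacian

/-- `ℝⁿ` with its Euclidean structure. -/
abbrev Rn (n : ℕ) : Type := EuclideanSpace ℝ (Fin n)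

/-- Complex-valued `L²(ℝⁿ)`. -/
abbrev L2Rn (n : ℕ) : Type := Lp (α := Rn n) ℂ 2

/-- `u ∈ C([0,∞); L²(ℝⁿ))` is the solution of the free Schrödinger initial value problem
`∂ₜu = iΔu` for `t > 0`, `u(0) = u₀`. The equation is understood in the sense of tempered
distributions: for every Schwartz function `φ` and every `t > 0`,
`d/dt ∫ φ(x) u(x,t) dx = ∫ (Δφ)(x) (i u(x,t)) dx`. -/
structure IsFreeSchrodingerSolution {n : ℕ} (u₀ : L2Rn n) (u : ℝ → L2Rn n) : Prop where
  continuousOn : ContinuousOn u (Ici 0)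
  initial : u 0 = u₀
  equation : ∀ φ : 𝓢(Rn n, ℂ), ∀ t : ℝ, 0 < t →
    HasDerivAt (fun s : ℝ => ∫ x, φ x * u s x)
      (∫ x, (Δ φ) x * (Complex.I * u t x)) t

/-- The unitary Fourier transform on `L²(ℝⁿ)` normalized by
`f̂(ξ) = (2π)^(-n/2) ∫ e^(-i x·ξ) f(x) dx`, obtained by rescaling Mathlib's `L²` Fourier transform
`𝓕`, which is normalized by `𝓕 f (ξ) = ∫ e^(-2πi x·ξ) f(x) dx`. (The dilation preserves null
sets, so this is well defined almost everywhere.) -/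
noncomputable def fourierHat {n : ℕ} (f : L2Rn n) : Rn n → ℂ := fun ξ =>
  (((2 * Real.pi) ^ (-(n : ℝ) / 2) : ℝ) : ℂ) * (𝓕 f : L2Rn n) ((2 * Real.pi)⁻¹ • ξ)

/-- The weighted norm `‖e^w f‖₂`, with value `∞` when `e^w f ∉ L²(ℝⁿ)`. -/
noncomputable def expWeightNorm {n : ℕ} (w : Rn n → ℝ) (f : Rn n → ℂ) : ℝ≥0∞ :=
  eLpNorm (fun x => (Real.exp (w x) : ℂ) * f x) 2 volume

/-! A Gaussian weight is an average of linear exponentials: up to a constant, e^{2|y|²} = ∫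
e^{-|v|²/2} e^{2v·y} dv. Taking y = (x+a)/r and using Hölder's inequality in v, both inequalities
reduce to log-convexity for the weights e^{p v·x}, one direction v at a time
(`expWeightNorm_gaussian_interp_le`). The centres 2tν contribute only factors e^{p v·a}, and these
balance exactly.

For linear weights everything is read off f = u(0) through N(p,q) = ‖e^{q v·ξ} 𝓕[e^{p v·x} f]‖₂.
Formally, multiplying by e^{p v·x} moves the frequency to ξ + ipv/(2π), and there the multiplier
e^{-4π²it|ξ|²} of the flow has modulus e^{4πtp v·ξ}. Thus N(p,4πtp) is the norm of e^{p v·x}u(t). In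
particular N(p₁,0) belongs to time 0 and N(p₀,4πTp₀) to time T, while N(0,2πq) is a weighted norm of
the unitary Fourier transform. For p = 1/(αt+β), the point (p,4πtp) lies on the segment joining the
two data points, and θ or μ is its barycentric coordinate.

The core is that log N is convex along segments
(`SuperExpDecay.expWeightNorm_expFourier_interp_le`), by the three lines theorem. An imaginary shift
of p translates the frequency and so changes the weighted norm exponentially; an explicit entire
factor cancels this growth.

Decay of u(t) at the intermediate time is not known in advance. There only the inequality with
N(p,4πtp) is proved, by Gaussian regularization and Fatou
(`SuperExpDecay.expWeightNorm_le_of_fourier_eq`). At time T, where decay is available, analytic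
continuation gives equality. -/

/-! ### Holomorphic parameter integrals. -/

open Filter Topology in
/-- An integral depending holomorphically on a complex parameter, locally uniformly dominated in
that parameter, is an entire function of it. -/
theorem differentiable_integral_of_dominated {X : Type*} [MeasurableSpace X] {μ : Measure X}
    {Φ : ℂ → X → ℂ} (hm : ∀ z, AEStronglyMeasurable (Φ z) μ)
    (hd : ∀ x, Differentiable ℂ (fun z => Φ z x))
    (hb : ∀ R : ℝ, ∃ b : X → ℝ, Integrable b μ ∧ ∀ z, ‖z‖ ≤ R → ∀ x, ‖Φ z x‖ ≤ b x) :
    Differentiable ℂ (fun z => ∫ x, Φ z x ∂μ) := by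
  intro z₀
  -- The unit circle about any point of the unit ball at z₀ stays within norm ‖z₀‖ + 2, so by
  -- Cauchy's estimate the same b also dominates the derivatives.
  obtain ⟨b, hbi, hb⟩ := hb (‖z₀‖ + 2)
  have hmeas : AEStronglyMeasurable (fun x => deriv (fun z => Φ z x) z₀) μ := by
    have hq : ∀ t : ℂ, AEStronglyMeasurable (fun x => slope (fun z => Φ z x) z₀ t) μ := fun t =>
      (((hm t).sub (hm z₀)).const_mul (t - z₀)⁻¹).congr (ae_of_all _ fun x => by
        simp [slope_def_module])
    exact aestronglyMeasurable_of_tendsto_ae (𝓝[≠] z₀) hq (ae_of_all _ fun x =>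
      hasDerivAt_iff_tendsto_slope.1 ((hd x) z₀).hasDerivAt)
  refine (hasDerivAt_integral_of_dominated_loc_of_deriv_le (bound := b)
    (F' := fun z x => deriv (fun z => Φ z x) z)
    (Metric.ball_mem_nhds z₀ one_pos) (Eventually.of_forall hm) ?_ hmeas ?_ hbi ?_).2.differentiableAt
  · exact hbi.mono' (hm z₀) (ae_of_all _ fun x => hb z₀ (by linarith) x)
  · refine ae_of_all _ fun x z hz => ?_
    have h := Complex.norm_deriv_le_of_forall_mem_sphere_norm_le (c := z) (R := 1) (C := b x)
      (f := fun z => Φ z x) one_pos (hd x).diffContOnCl fun w hw => hb w ?_ x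
    · simpa using h
    · rw [mem_sphere_iff_norm] at hw
      rw [mem_ball_iff_norm] at hz
      have h1 := norm_add_le (w - z) z
      have h2 := norm_add_le (z - z₀) z₀
      simp only [sub_add_cancel] at h1 h2
      linarith
  · exact ae_of_all _ fun x z _ => ((hd x) z).hasDerivAt

/-! ### The L² Fourier transform as an integral on L¹ ∩ L². -/

section FourierL2

variable {n : ℕ}

theorem integral_mul_fourier_L2 (φ : 𝓢(Rn n, ℂ)) (f : L2Rn n) :
    ∫ x, φ x * (𝓕 f : L2Rn n) x = ∫ x, (𝓕 φ) x * f x := by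
  have h := congrArg (fun T => T φ) (Lp.fourier_toTemperedDistribution_eq f)
  simpa using h.symm

theorem integral_mul_fourier_of_integrable {φ f : Rn n → ℂ} (hφ : Integrable φ)
    (hf : Integrable f) : ∫ x, φ x * 𝓕 f x = ∫ x, 𝓕 φ x * f x := by
  simpa using! (VectorFourier.integral_fourierIntegral_smul_eq_flip (L := innerₗ (Rn n))
      Real.continuous_fourierChar continuous_inner hφ hf).symm

theorem continuous_fourier_of_integrable {f : Rn n → ℂ} (hf : Integrable f) :
    Continuous (𝓕 f) :=
  VectorFourier.fourierIntegral_continuous Real.continuous_fourierChar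
    (L := innerₗ (Rn n)) continuous_inner hf

/-- Two locally integrable functions with the same integrals against Schwartz functions agree
almost everywhere. -/
theorem ae_eq_of_integral_schwartz_mul_eq {f g : Rn n → ℂ} (hf : LocallyIntegrable f)
    (hg : LocallyIntegrable g)
    (h : ∀ φ : 𝓢(Rn n, ℂ), HasCompactSupport φ → ∫ x, φ x * f x = ∫ x, φ x * g x) :
    f =ᵐ[volume] g := by
  refine ae_eq_of_integral_contDiff_smul_eq hf hg fun χ hχ hχc => ?_
  have h1 : HasCompactSupport (Complex.ofRealCLM ∘ χ) := hχc.comp_left rfl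
  have h2 : ContDiff ℝ (⊤ : ℕ∞) (Complex.ofRealCLM ∘ χ) := by fun_prop
  simpa using h (h1.toSchwartzMap h2) h1

theorem coeFn_fourier_L2 (f : L2Rn n) (hf : Integrable f) :
    (𝓕 f : L2Rn n) =ᵐ[volume] 𝓕 (f : Rn n → ℂ) := by
  refine ae_eq_of_integral_schwartz_mul_eq
    ((Lp.memLp _).locallyIntegrable one_le_two)
    (continuous_fourier_of_integrable hf).locallyIntegrable fun φ _ => ?_
  rw [integral_mul_fourier_L2, integral_mul_fourier_of_integrable φ.integrable hf,
    SchwartzMap.fourier_coe]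

/-- Plancherel's theorem on `L¹ ∩ L²`. -/
theorem eLpNorm_fourier_eq {f : Rn n → ℂ} (hf : Integrable f) (hf2 : MemLp f 2) :
    eLpNorm (𝓕 f) 2 = eLpNorm f 2 := by
  have hae := hf2.coeFn_toLp
  have h1 := coeFn_fourier_L2 (hf2.toLp f) (hf.congr hae.symm)
  have h2 : 𝓕 (hf2.toLp f : Rn n → ℂ) = 𝓕 f := by
    ext ξ
    simp only [Real.fourier_eq]
    exact integral_congr_ae (hae.mono fun x hx => by simp only [hx])
  rw [h2] at h1
  rw [← eLpNorm_congr_ae h1, ← eLpNorm_congr_ae hae, ← Lp.enorm_def, ← Lp.enorm_def,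
    ← ofReal_norm, ← ofReal_norm, Lp.norm_fourier_eq]

theorem continuous_fourierInv_of_integrable {f : Rn n → ℂ} (hf : Integrable f) :
    Continuous (𝓕⁻ f) := by
  have h : 𝓕⁻ f = 𝓕 f ∘ Neg.neg := by
    ext x; simp [Real.fourierInv_eq_fourier_neg]
  rw [h]
  exact (continuous_fourier_of_integrable hf).comp continuous_neg

theorem eLpNorm_fourierInv_eq {f : Rn n → ℂ} (hf : Integrable f) (hf2 : MemLp f 2) :
    eLpNorm (𝓕⁻ f) 2 = eLpNorm f 2 := by
  rw [← eLpNorm_fourier_eq hf hf2]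
  have h : 𝓕⁻ f = 𝓕 f ∘ Neg.neg := by
    ext x; simp [Real.fourierInv_eq_fourier_neg]
  rw [h]
  exact eLpNorm_comp_measurePreserving (continuous_fourier_of_integrable hf).aestronglyMeasurable
    (Measure.measurePreserving_neg volume)

theorem coeFn_fourierInv_L2 (f : L2Rn n) (hf : Integrable f) :
    (𝓕⁻ f : L2Rn n) =ᵐ[volume] 𝓕⁻ (f : Rn n → ℂ) := by
  refine ae_eq_of_integral_schwartz_mul_eq
    ((Lp.memLp _).locallyIntegrable one_le_two)
    (continuous_fourierInv_of_integrable hf).locallyIntegrable fun φ _ => ?_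
  have h := congrArg (fun T => T (𝓕 (𝓕⁻ φ))) (Lp.fourierInv_toTemperedDistribution_eq f)
  have h' : ∫ x, φ x * (𝓕⁻ f : L2Rn n) x = ∫ x, (𝓕⁻ φ) x * f x := by
    simpa using h.symm
  rw [h', SchwartzMap.fourierInv_coe, ← integral_neg_eq_self]
  have e : ∀ x, 𝓕⁻ (φ : Rn n → ℂ) (-x) = 𝓕 (φ : Rn n → ℂ) x := fun x => by
    simp [Real.fourierInv_eq_fourier_neg]
  have e' : ∀ x, 𝓕⁻ (f : Rn n → ℂ) x = 𝓕 (fun y => f (-y)) x := fun x => by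
    simp [Real.fourierInv_eq_fourier_comp_neg]
  simp only [e, e']
  exact (integral_mul_fourier_of_integrable φ.integrable hf.comp_neg).symm

end FourierL2

/-! ### Differentiating the Schrödinger phase against test functions. -/

open Filter Topology in
/-- Product rule for a bilinear pairing whose second argument is only weakly differentiable. -/
theorem HasDerivAt.clm_apply_of_weak {E F G : Type*} [NormedAddCommGroup E] [NormedSpace ℝ E]
    [NormedAddCommGroup F] [NormedSpace ℝ F] [NormedAddCommGroup G] [NormedSpace ℝ G]
    (B : E →L[ℝ] F →L[ℝ] G) {A : ℝ → E} {A' : E} {U : ℝ → F} {c : G} {s : ℝ}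
    (hA : HasDerivAt A A' s) (hU : ContinuousAt U s)
    (hw : HasDerivAt (fun r => B (A s) (U r)) c s) :
    HasDerivAt (fun r => B (A r) (U r)) (B A' (U s) + c) s := by
  rw [hasDerivAt_iff_tendsto_slope] at hA hw ⊢
  have h1 : Tendsto (fun r => B (slope A s r) (U r)) (𝓝[≠] s) (𝓝 (B A' (U s))) := by
    have h2 : Tendsto (fun r => B (slope A s r)) (𝓝[≠] s) (𝓝 (B A')) :=
      (B.continuous.tendsto _).comp hA
    exact (isBoundedBilinearMap_apply.continuous.tendsto (B A', U s)).comp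
      (h2.prodMk_nhds (hU.tendsto.mono_left nhdsWithin_le_nhds))
  refine (h1.add hw).congr fun r => ?_
  simp only [slope_def_module, map_smul, map_sub, smul_apply,
    sub_apply, smul_sub]
  abel

section Phase

variable {n : ℕ}

theorem laplacian_fourier_schwartz (ψ : 𝓢(Rn n, ℂ)) :
    Δ (𝓕 ψ) = 𝓕 (SchwartzMap.smulLeftCLM ℂ
      (fun ξ : Rn n => (-((2 * Real.pi) ^ 2 * ‖ξ‖ ^ 2) : ℝ)) ψ) := by
  let b := stdOrthonormalBasis ℝ (Rn n)
  have hb : ∀ m : Rn n, (fun x : Rn n => inner ℝ x m).HasTemperateGrowth := fun m => by fun_prop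
  rw [SchwartzMap.laplacian_eq_sum b]
  simp only [SchwartzMap.lineDerivOp_fourier_eq]
  have hsum : ∀ F : Fin (Module.finrank ℝ (Rn n)) → 𝓢(Rn n, ℂ), ∑ i, 𝓕 (F i) = 𝓕 (∑ i, F i) :=
    fun F => (map_sum (FourierTransform.fourierCLM ℂ 𝓢(Rn n, ℂ)) F Finset.univ).symm
  rw [hsum]
  congr 1
  ext ξ
  rw [SchwartzMap.smulLeftCLM_apply_apply (by fun_prop), sum_apply,
    ← b.sum_sq_inner_left ξ]
  simp only [smul_apply, SchwartzMap.smulLeftCLM_apply_apply (hb _),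
    smul_eq_mul, Complex.real_smul]
  push_cast
  rw [Finset.mul_sum, ← Finset.sum_neg_distrib, Finset.sum_mul]
  refine Finset.sum_congr rfl fun i _ => ?_
  linear_combination (4 * Real.pi ^ 2 * (inner ℝ ξ (b i) : ℂ) ^ 2 * ψ ξ) * Complex.I_sq

/-- The Fourier multiplier `e^{i(2π)²|ξ|²s}` inverse to the free Schrödinger flow. -/
noncomputable def schrodingerPhase (s : ℝ) (ξ : Rn n) : ℂ :=
  Complex.exp (((2 * Real.pi) ^ 2 * ‖ξ‖ ^ 2 * s : ℝ) * Complex.I)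

theorem norm_schrodingerPhase (s : ℝ) (ξ : Rn n) : ‖schrodingerPhase s ξ‖ = 1 :=
  Complex.norm_exp_ofReal_mul_I _

theorem contDiff_schrodingerPhase (s : ℝ) :
    ContDiff ℝ (⊤ : ℕ∞) (schrodingerPhase s : Rn n → ℂ) := by
  have h : ContDiff ℝ (⊤ : ℕ∞) (fun ξ : Rn n => (2 * Real.pi) ^ 2 * ‖ξ‖ ^ 2 * s) :=
    (contDiff_const.mul (contDiff_norm_sq ℝ)).mul contDiff_const
  exact ((Complex.ofRealCLM.contDiff.comp h).mul contDiff_const).cexp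

theorem hasCompactSupport_mul_schrodingerPhase (φ : 𝓢(Rn n, ℂ)) (hφ : HasCompactSupport φ)
    (s : ℝ) : HasCompactSupport (fun ξ => φ ξ * schrodingerPhase s ξ) :=
  hφ.mul_right

/-- The product of a test function and the Schrödinger phase. -/
noncomputable def phaseTest (φ : 𝓢(Rn n, ℂ)) (hφ : HasCompactSupport φ) (s : ℝ) : 𝓢(Rn n, ℂ) :=
  (hasCompactSupport_mul_schrodingerPhase φ hφ s).toSchwartzMap
    ((φ.smooth _).mul (contDiff_schrodingerPhase s))

theorem phaseTest_apply (φ : 𝓢(Rn n, ℂ)) (hφ : HasCompactSupport φ) (s : ℝ) (ξ : Rn n) :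
    phaseTest φ hφ s ξ = φ ξ * schrodingerPhase s ξ := rfl

/-- Multiplication of a Schwartz function by `i(2π)²|ξ|²`. -/
noncomputable def symbolTest (φ : 𝓢(Rn n, ℂ)) : 𝓢(Rn n, ℂ) :=
  Complex.I • SchwartzMap.smulLeftCLM ℂ (fun ξ : Rn n => ((2 * Real.pi) ^ 2 * ‖ξ‖ ^ 2 : ℝ)) φ

theorem symbolTest_apply (φ : 𝓢(Rn n, ℂ)) (ξ : Rn n) :
    symbolTest φ ξ = Complex.I * (((2 * Real.pi) ^ 2 * ‖ξ‖ ^ 2 : ℝ) * φ ξ) := by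
  simp only [symbolTest, smul_apply]
  rw [SchwartzMap.smulLeftCLM_apply_apply (by fun_prop)]
  simp

/-- The `L²` class of a Schwartz function. -/
noncomputable def schwartzL2 (φ : 𝓢(Rn n, ℂ)) : L2Rn n := φ.toLp 2 volume

theorem coeFn_schwartzL2 (φ : 𝓢(Rn n, ℂ)) : schwartzL2 φ =ᵐ[volume] φ :=
  φ.coeFn_toLp 2 volume

theorem norm_sub_sub_smul_le_of_ae {a b c d : L2Rn n} {h C : ℝ}
    (H : ∀ᵐ ξ, ‖a ξ - b ξ - h * c ξ‖ ≤ C * ‖d ξ‖) : ‖a - b - h • c‖ ≤ C * ‖d‖ := by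
  refine Lp.norm_le_mul_norm_of_ae_le_mul ?_
  filter_upwards [H, Lp.coeFn_sub (a - b) (h • c), Lp.coeFn_sub a b, Lp.coeFn_smul h c]
    with ξ e0 e1 e2 e3
  rwa [e1, Pi.sub_apply, e2, Pi.sub_apply, e3, Pi.smul_apply, Complex.real_smul]

theorem norm_phase_sub_sub_le {s h M : ℝ} (hM : 0 < M) (hh : |h| ≤ M⁻¹) {ξ : Rn n}
    (hξ : (2 * Real.pi) ^ 2 * ‖ξ‖ ^ 2 ≤ M) (w : ℂ) :
    ‖w * schrodingerPhase (s + h) ξ - w * schrodingerPhase s ξ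
      - h * (Complex.I * (((2 * Real.pi) ^ 2 * ‖ξ‖ ^ 2 : ℝ) * (w * schrodingerPhase s ξ)))‖
      ≤ (M ^ 2 * h ^ 2) * ‖w‖ := by
  set a : ℝ := (2 * Real.pi) ^ 2 * ‖ξ‖ ^ 2 with ha
  have ha0 : 0 ≤ a := by positivity
  have hz : ‖((a * h : ℝ) : ℂ) * Complex.I‖ ≤ 1 := by
    rw [norm_mul, Complex.norm_I, mul_one, Complex.norm_real, Real.norm_eq_abs, abs_mul,
      abs_of_nonneg ha0]
    calc a * |h| ≤ M * M⁻¹ := by gcongr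
      _ = 1 := mul_inv_cancel₀ hM.ne'
  -- For |z| ≤ 1 the remainder e^z - 1 - z is at most |z|², which is why |h| is restricted to M⁻¹.
  have hexp := Complex.norm_exp_sub_one_sub_id_le hz
  have e8 : schrodingerPhase (s + h) ξ
      = schrodingerPhase s ξ * Complex.exp (((a * h : ℝ) : ℂ) * Complex.I) := by
    rw [schrodingerPhase, schrodingerPhase, ← Complex.exp_add, ← ha]
    congr 1; push_cast; ring
  have e9 : w * schrodingerPhase (s + h) ξ - w * schrodingerPhase s ξ
      - h * (Complex.I * (a * (w * schrodingerPhase s ξ)))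
      = w * schrodingerPhase s ξ * (Complex.exp (((a * h : ℝ) : ℂ) * Complex.I) - 1
        - ((a * h : ℝ) : ℂ) * Complex.I) := by
    rw [e8]; push_cast; ring
  rw [e9, norm_mul, norm_mul, norm_schrodingerPhase, mul_one, mul_comm]
  gcongr
  refine hexp.trans ?_
  rw [norm_mul, Complex.norm_I, mul_one, Complex.norm_real, Real.norm_eq_abs, sq_abs, mul_pow]
  gcongr

/-- Compact support makes the symbol bounded where φ lives, so the pointwise Taylor remainder is
O(h²) uniformly and the derivative exists in L² norm. -/
theorem hasDerivAt_schwartzL2_phaseTest (φ : 𝓢(Rn n, ℂ)) (hφ : HasCompactSupport φ) (s : ℝ) :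
    HasDerivAt (fun r => schwartzL2 (phaseTest φ hφ r))
      (schwartzL2 (symbolTest (phaseTest φ hφ s))) s := by
  obtain ⟨R, hR⟩ := hφ.isBounded.exists_norm_le
  set M : ℝ := (2 * Real.pi) ^ 2 * R ^ 2 + 1 with hM
  have hMpos : 0 < M := by positivity
  rw [hasDerivAt_iff_isLittleO_nhds_zero]
  refine Asymptotics.IsBigO.trans_isLittleO (g := fun h : ℝ => h ^ 2) ?_
    (by simpa using Asymptotics.isLittleO_pow_id (𝕜 := ℝ) one_lt_two)
  refine Asymptotics.IsBigO.of_bound (M ^ 2 * ‖schwartzL2 φ‖) ?_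
  filter_upwards [Metric.ball_mem_nhds (0 : ℝ) (ε := M⁻¹) (by positivity)] with h hh
  have hh' : |h| ≤ M⁻¹ := by simpa using (mem_ball_zero_iff.1 hh).le
  have key : ‖schwartzL2 (phaseTest φ hφ (s + h)) - schwartzL2 (phaseTest φ hφ s)
      - h • schwartzL2 (symbolTest (phaseTest φ hφ s))‖ ≤ (M ^ 2 * h ^ 2) * ‖schwartzL2 φ‖ := by
    refine norm_sub_sub_smul_le_of_ae ?_
    filter_upwards [coeFn_schwartzL2 (phaseTest φ hφ (s + h)),
      coeFn_schwartzL2 (phaseTest φ hφ s), coeFn_schwartzL2 (symbolTest (phaseTest φ hφ s)),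
      coeFn_schwartzL2 φ] with ξ e4 e5 e6 e7
    rw [e4, e5, e6, e7, symbolTest_apply, phaseTest_apply, phaseTest_apply]
    by_cases hξ : φ ξ = 0
    · simp [hξ]
    refine norm_phase_sub_sub_le hMpos hh' ?_ _
    have h1 := hR ξ (subset_tsupport _ hξ)
    have h2 : ‖ξ‖ ^ 2 ≤ R ^ 2 := by gcongr
    rw [hM]
    nlinarith [sq_nonneg (2 * Real.pi)]
  rw [Real.norm_of_nonneg (sq_nonneg h)]
  linarith

theorem locallyIntegrable_schrodingerPhase_mul (s : ℝ) (v : L2Rn n) :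
    LocallyIntegrable (fun ξ => schrodingerPhase s ξ * v ξ) := by
  refine MemLp.locallyIntegrable (p := 2) ?_ one_le_two
  refine (Lp.memLp v).of_le
    ((contDiff_schrodingerPhase s).continuous.aestronglyMeasurable.mul
      (Lp.aestronglyMeasurable v)) (ae_of_all _ fun ξ => ?_)
  rw [norm_mul, norm_schrodingerPhase, one_mul]

end Phase

/-! ### The equation in Fourier variables. -/

section Flow

variable {n : ℕ}

/-- The bilinear pairing `∫ fg` on `L²`. -/
noncomputable def pairingL2 : L2Rn n →L[ℝ] L2Rn n →L[ℝ] ℂ :=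
  (ContinuousLinearMap.mul ℝ ℂ).lpPairing volume 2 2

theorem pairingL2_apply (f g : L2Rn n) : pairingL2 f g = ∫ x, f x * g x := by
  rw [pairingL2, ContinuousLinearMap.lpPairing_eq_integral]
  rfl

theorem pairingL2_schwartz (φ : 𝓢(Rn n, ℂ)) (g : L2Rn n) :
    pairingL2 (schwartzL2 φ) g = ∫ x, φ x * g x := by
  rw [pairingL2_apply]
  exact integral_congr_ae ((coeFn_schwartzL2 φ).mono fun x hx => by simp only [hx])

-- Pairing 𝓕 (u s) with φ times the inverse phase gives a function of s with zero derivative: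
-- differentiating the phase and using the equation produce opposite terms.
open Filter Topology in
theorem IsFreeSchrodingerSolution.fourier_eq {u₀ : L2Rn n} {u : ℝ → L2Rn n}
    (hu : IsFreeSchrodingerSolution u₀ u) {t : ℝ} (ht : 0 ≤ t) :
    ∀ᵐ ξ, schrodingerPhase t ξ * (𝓕 (u t) : L2Rn n) ξ = (𝓕 (u 0) : L2Rn n) ξ := by
  have hU : ContinuousOn (fun s => (𝓕 (u s) : L2Rn n)) (Ici 0) :=
    (Lp.fourierTransformₗᵢ (Rn n) ℂ).continuous.comp_continuousOn hu.continuousOn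
  have hweak : ∀ ψ : 𝓢(Rn n, ℂ), ∀ s : ℝ, 0 < s →
      HasDerivAt (fun r => pairingL2 (schwartzL2 ψ) (𝓕 (u r)))
        (-pairingL2 (schwartzL2 (symbolTest ψ)) (𝓕 (u s))) s := by
    intro ψ s hs
    -- Testing with 𝓕 ψ turns the Laplacian into multiplication of ψ by the symbol.
    have h := hu.equation (𝓕 ψ) s hs
    simp only [pairingL2_schwartz, integral_mul_fourier_L2]
    convert h using 1
    rw [laplacian_fourier_schwartz, ← integral_neg]
    rw [show (symbolTest ψ) = -(Complex.I • SchwartzMap.smulLeftCLM ℂ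
      (fun ξ : Rn n => (-((2 * Real.pi) ^ 2 * ‖ξ‖ ^ 2) : ℝ)) ψ) from ?_]
    · refine integral_congr_ae (ae_of_all _ fun x => ?_)
      simp only [FourierTransform.fourier_neg, FourierTransform.fourier_smul,
        neg_apply, smul_apply, smul_eq_mul]
      ring
    · ext ξ
      rw [symbolTest_apply, neg_apply, smul_apply,
        SchwartzMap.smulLeftCLM_apply_apply (by fun_prop)]
      simp
  have hconst : ∀ φ : 𝓢(Rn n, ℂ), ∀ hφ : HasCompactSupport φ,
      pairingL2 (schwartzL2 (phaseTest φ hφ t)) (𝓕 (u t))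
        = pairingL2 (schwartzL2 (phaseTest φ hφ 0)) (𝓕 (u 0)) := by
    intro φ hφ
    set D : ℝ → ℂ := fun s => pairingL2 (schwartzL2 (phaseTest φ hφ s)) (𝓕 (u s)) with hD
    have hderiv : ∀ s, 0 < s → HasDerivAt D 0 s := by
      intro s hs
      have := (hasDerivAt_schwartzL2_phaseTest φ hφ s).clm_apply_of_weak pairingL2
        (hU.continuousAt (Ici_mem_nhds hs)) (hweak (phaseTest φ hφ s) s hs)
      rwa [add_neg_cancel] at this
    have hcont : ContinuousOn D (Ici 0) := by
      have hA : Continuous (fun r => schwartzL2 (phaseTest φ hφ r)) :=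
        continuous_iff_continuousAt.2 fun s => (hasDerivAt_schwartzL2_phaseTest φ hφ s).continuousAt
      exact (pairingL2.continuous.comp hA).continuousOn.clm_apply hU
    rcases ht.eq_or_lt with rfl | ht
    · rfl
    have hlim : Tendsto D (𝓝[>] 0) (𝓝 (D 0)) :=
      (hcont 0 self_mem_Ici).mono_left (nhdsWithin_mono _ Ioi_subset_Ici_self)
    refine tendsto_nhds_unique (Tendsto.congr' ?_ tendsto_const_nhds) hlim
    -- The equation holds only for positive times, so constancy is proved on [a, t] and a tends to 0
    -- by continuity.
    filter_upwards [Ioo_mem_nhdsGT ht] with a ha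
    exact constant_of_has_deriv_right_zero
      (hcont.mono fun x hx => ha.1.le.trans hx.1)
      (fun x hx => (hderiv x (ha.1.trans_le hx.1)).hasDerivWithinAt) t ⟨ha.2.le, le_rfl⟩
  refine ae_eq_of_integral_schwartz_mul_eq (locallyIntegrable_schrodingerPhase_mul t _)
    ((Lp.memLp _).locallyIntegrable one_le_two) fun φ hφ => ?_
  have h := hconst φ hφ
  simp only [pairingL2_schwartz, phaseTest_apply] at h
  simpa [schrodingerPhase, mul_assoc] using h

end Flow

/-! ### Superexponential decay from Gaussian weights. -/

section Decay

variable {n : ℕ}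

/-- Half of the Gaussian absorbs the linear term, by completing the square. -/
theorem integrable_exp_linear_sub_sq (c : ℝ) {δ : ℝ} (hδ : 0 < δ) :
    Integrable (fun x : Rn n => Real.exp (c * ‖x‖ - δ * ‖x‖ ^ 2)) := by
  have h : Integrable (fun x : Rn n => Real.exp (c ^ 2 / (2 * δ)) *
      ‖Complex.exp (-((δ / 2 : ℝ) : ℂ) * ‖x‖ ^ 2 + 0 * (inner ℝ (0 : Rn n) x : ℝ))‖) :=
    (GaussianFourier.integrable_cexp_neg_mul_sq_norm_add
      (by rw [Complex.ofReal_re]; positivity) 0 0).norm.const_mul _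
  refine h.mono' (Continuous.aestronglyMeasurable (by fun_prop)) (ae_of_all _ fun x => ?_)
  rw [Real.norm_of_nonneg (Real.exp_pos _).le, Complex.norm_exp, ← Real.exp_add]
  refine Real.exp_le_exp.2 ?_
  have e : (-((δ / 2 : ℝ) : ℂ) * ‖x‖ ^ 2 + 0 * (inner ℝ (0 : Rn n) x : ℝ)).re
      = -(δ / 2) * ‖x‖ ^ 2 := by
    rw [zero_mul, add_zero, ← Complex.ofReal_pow, ← Complex.ofReal_neg, ← Complex.ofReal_mul,
      Complex.ofReal_re]
  rw [e]
  have h1 : c ^ 2 / (2 * δ) + -(δ / 2) * ‖x‖ ^ 2 - (c * ‖x‖ - δ * ‖x‖ ^ 2)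
      = (c - δ * ‖x‖) ^ 2 / (2 * δ) := by field_simp; ring
  have h2 : 0 ≤ (c - δ * ‖x‖) ^ 2 / (2 * δ) := by positivity
  linarith

/-- Functions that lie in `L¹ ∩ L²` after multiplication by any exponential `e^{c|x|}`. -/
structure SuperExpDecay (f : Rn n → ℂ) : Prop where
  memLp : ∀ c : ℝ, MemLp (fun x => (Real.exp (c * ‖x‖) : ℂ) * f x) 2
  integrable : ∀ c : ℝ, Integrable (fun x => (Real.exp (c * ‖x‖) : ℂ) * f x)

/-- Write e^{c|x|} as the Gaussian weight times a kernel `k c`. The kernel is bounded, which gives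
L², and square integrable, which gives L¹ by Cauchy–Schwarz. -/
theorem superExpDecay_of_expWeightNorm_ne_top {f : Rn n → ℂ} (hf : AEStronglyMeasurable f)
    (a : Rn n) {r : ℝ} (hr : 0 < r)
    (h : expWeightNorm (fun x => ‖x + a‖ ^ 2 / r ^ 2) f ≠ ∞) : SuperExpDecay f := by
  have hmem : MemLp (fun x => (Real.exp (‖x + a‖ ^ 2 / r ^ 2) : ℂ) * f x) 2 :=
    ⟨(Continuous.aestronglyMeasurable (by fun_prop)).mul hf, lt_top_iff_ne_top.2 h⟩
  set k : ℝ → Rn n → ℂ := fun c x => (Real.exp (c * ‖x‖ - ‖x + a‖ ^ 2 / r ^ 2) : ℂ) with hk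
  have hkc : ∀ c, Continuous (k c) := fun c => by fun_prop
  have hfac : ∀ c, (fun x => (Real.exp (c * ‖x‖) : ℂ) * f x)
      = fun x => k c x * ((Real.exp (‖x + a‖ ^ 2 / r ^ 2) : ℂ) * f x) := fun c => by
    ext x
    rw [hk, ← mul_assoc, ← Complex.ofReal_mul, ← Real.exp_add, sub_add_cancel]
  have hδ : 0 < 1 / (2 * r ^ 2) := by positivity
  have hbound : ∀ c x, c * ‖x‖ - ‖x + a‖ ^ 2 / r ^ 2
      ≤ ‖a‖ ^ 2 / r ^ 2 + (c * ‖x‖ - 1 / (2 * r ^ 2) * ‖x‖ ^ 2) := fun c x => by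
    have h1 : ‖x‖ ≤ ‖x + a‖ + ‖a‖ := by
      simpa using norm_sub_le (x + a) a
    have h2 : ‖x‖ ^ 2 / 2 ≤ ‖x + a‖ ^ 2 + ‖a‖ ^ 2 := by
      nlinarith [norm_nonneg x, sq_nonneg (‖x + a‖ - ‖a‖), norm_nonneg a, norm_nonneg (x + a)]
    have h3 : ‖x‖ ^ 2 / 2 / r ^ 2 ≤ (‖x + a‖ ^ 2 + ‖a‖ ^ 2) / r ^ 2 := by gcongr
    have h4 : ‖x‖ ^ 2 / 2 / r ^ 2 = 1 / (2 * r ^ 2) * ‖x‖ ^ 2 := by field_simp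
    rw [add_div] at h3
    linarith
  have hk2 : ∀ c, MemLp (k c) 2 := fun c => by
    rw [memLp_two_iff_integrable_sq_norm (hkc c).aestronglyMeasurable]
    refine ((integrable_exp_linear_sub_sq (n := n) (2 * c) (δ := 2 * (1 / (2 * r ^ 2)))
      (by positivity)).const_mul (Real.exp (2 * (‖a‖ ^ 2 / r ^ 2)))).mono'
      (Continuous.aestronglyMeasurable (by fun_prop)) (ae_of_all _ fun x => ?_)
    rw [Real.norm_of_nonneg (sq_nonneg _), hk, Complex.norm_real,
      Real.norm_of_nonneg (Real.exp_pos _).le, ← Real.exp_nat_mul, ← Real.exp_add]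
    refine Real.exp_le_exp.2 ?_
    have := hbound c x
    push_cast
    linarith
  refine ⟨fun c => ?_, fun c => ?_⟩
  · rw [hfac c]
    -- The term c²r²/2 is the maximum over s of cs - s²/(2r²).
    refine hmem.of_le_mul (c := Real.exp (‖a‖ ^ 2 / r ^ 2 + c ^ 2 * r ^ 2 / 2))
      ((hkc c).aestronglyMeasurable.mul hmem.1) (ae_of_all _ fun x => ?_)
    rw [norm_mul]
    gcongr
    rw [hk, Complex.norm_real, Real.norm_of_nonneg (Real.exp_pos _).le]
    refine Real.exp_le_exp.2 ((hbound c x).trans ?_)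
    have h1 : c ^ 2 * r ^ 2 / 2 - (c * ‖x‖ - 1 / (2 * r ^ 2) * ‖x‖ ^ 2)
      = (c * r ^ 2 - ‖x‖) ^ 2 / (2 * r ^ 2) := by field_simp; ring
    have h2 : 0 ≤ (c * r ^ 2 - ‖x‖) ^ 2 / (2 * r ^ 2) := by positivity
    linarith
  · rw [hfac c]
    exact (hk2 c).integrable_mul hmem

namespace SuperExpDecay

variable {f : Rn n → ℂ}

theorem aestronglyMeasurable (hf : SuperExpDecay f) : AEStronglyMeasurable f := by
  simpa using (hf.integrable 0).1

theorem norm_cexp_mul_le (f : Rn n → ℂ) {R : ℝ} (v : Rn n) {z : ℂ} (hz : |z.re| ≤ R) (x : Rn n) :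
    ‖Complex.exp (z * (inner ℝ v x : ℝ)) * f x‖ ≤
      ‖(Real.exp (R * ‖v‖ * ‖x‖) : ℂ) * f x‖ := by
  rw [norm_mul, norm_mul]
  gcongr
  rw [Complex.norm_exp, Complex.norm_real, Real.norm_of_nonneg (Real.exp_pos _).le,
    Complex.re_mul_ofReal]
  refine Real.exp_le_exp.2 ((le_abs_self _).trans ?_)
  rw [abs_mul, mul_assoc]
  exact mul_le_mul hz (abs_real_inner_le_norm v x) (abs_nonneg _) ((abs_nonneg _).trans hz)

theorem aestronglyMeasurable_cexp_mul (hf : SuperExpDecay f) (v : Rn n) (z : ℂ) :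
    AEStronglyMeasurable (fun x => Complex.exp (z * (inner ℝ v x : ℝ)) * f x) :=
  (Continuous.aestronglyMeasurable (by fun_prop)).mul hf.aestronglyMeasurable

theorem integrable_cexp_mul (hf : SuperExpDecay f) (v : Rn n) (z : ℂ) :
    Integrable (fun x => Complex.exp (z * (inner ℝ v x : ℝ)) * f x) :=
  (hf.integrable _).mono (hf.aestronglyMeasurable_cexp_mul v z)
    (ae_of_all _ fun x => norm_cexp_mul_le f v le_rfl x)

theorem memLp_cexp_mul (hf : SuperExpDecay f) (v : Rn n) (z : ℂ) :
    MemLp (fun x => Complex.exp (z * (inner ℝ v x : ℝ)) * f x) 2 :=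
  (hf.memLp _).mono (hf.aestronglyMeasurable_cexp_mul v z)
    (ae_of_all _ fun x => norm_cexp_mul_le f v le_rfl x)

end SuperExpDecay

end Decay

/-! ### The Fourier–Laplace transform along a direction. -/

section ExpFourier

variable {n : ℕ}

/-- The Fourier transform of `e^{z⟨v,x⟩} f`, that is, the Fourier-Laplace transform of `f` along
the complex direction `v`. -/
noncomputable def expFourier (f : Rn n → ℂ) (v : Rn n) (z : ℂ) : Rn n → ℂ :=
  𝓕 (fun x => Complex.exp (z * (inner ℝ v x : ℝ)) * f x)

theorem expFourier_zero (f : Rn n → ℂ) (v : Rn n) : expFourier f v 0 = 𝓕 f := by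
  simp [expFourier]

theorem expFourier_apply (f : Rn n → ℂ) (v : Rn n) (z : ℂ) (ξ : Rn n) :
    expFourier f v z ξ = ∫ x, Complex.exp (((-2 * Real.pi * inner ℝ x ξ : ℝ) : ℂ) * Complex.I) *
      (Complex.exp (z * (inner ℝ v x : ℝ)) * f x) := by
  simp only [expFourier, Real.fourier_eq', smul_eq_mul]

/-- The imaginary part of the exponent is a modulation, hence a translation in frequency. Every
later analytic continuation starts from this. -/
theorem expFourier_add_mul_I (f : Rn n → ℂ) (v : Rn n) (z : ℂ) (y : ℝ) (ξ : Rn n) :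
    expFourier f v (z + y * Complex.I) ξ = expFourier f v z (ξ - (y / (2 * Real.pi)) • v) := by
  rw [expFourier_apply, expFourier_apply]
  refine integral_congr_ae (ae_of_all _ fun x => ?_)
  simp only
  rw [← mul_assoc, ← mul_assoc, ← Complex.exp_add, ← Complex.exp_add]
  congr 2
  rw [inner_sub_right, inner_smul_right, real_inner_comm v x]
  have : (Real.pi : ℂ) ≠ 0 := by exact_mod_cast Real.pi_ne_zero
  push_cast
  field_simp
  ring

namespace SuperExpDecay

variable {f : Rn n → ℂ}

theorem continuous_expFourier (hf : SuperExpDecay f) (v : Rn n) (z : ℂ) : Continuous (expFourier f v z) :=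
  continuous_fourier_of_integrable (hf.integrable_cexp_mul v z)

theorem eLpNorm_expFourier (hf : SuperExpDecay f) (v : Rn n) (z : ℂ) : eLpNorm (expFourier f v z) 2 =
    eLpNorm (fun x => Complex.exp (z * (inner ℝ v x : ℝ)) * f x) 2 :=
  eLpNorm_fourier_eq (hf.integrable_cexp_mul v z) (hf.memLp_cexp_mul v z)

theorem exists_norm_expFourier_le (hf : SuperExpDecay f) (v : Rn n) (R : ℝ) :
    ∃ C : ℝ, 0 ≤ C ∧ ∀ z : ℂ, |z.re| ≤ R → ∀ ξ, ‖expFourier f v z ξ‖ ≤ C := by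
  refine ⟨∫ x, ‖(Real.exp (R * ‖v‖ * ‖x‖) : ℂ) * f x‖, by positivity, fun z hz ξ => ?_⟩
  rw [expFourier_apply]
  refine norm_integral_le_of_norm_le (hf.integrable _).norm (ae_of_all _ fun x => ?_)
  rw [norm_mul, Complex.norm_exp_ofReal_mul_I, one_mul]
  exact norm_cexp_mul_le f v hz x

theorem differentiable_expFourier (hf : SuperExpDecay f) (v ξ : Rn n) :
    Differentiable ℂ (fun z => expFourier f v z ξ) := by
  simp only [expFourier_apply]
  refine differentiable_integral_of_dominated (fun z => ?_) (fun x => ?_) (fun R => ?_)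
  · exact (Continuous.aestronglyMeasurable (by fun_prop)).mul (hf.aestronglyMeasurable_cexp_mul v z)
  · fun_prop
  · refine ⟨_, (hf.integrable (R * ‖v‖)).norm, fun z hz x => ?_⟩
    rw [norm_mul, Complex.norm_exp_ofReal_mul_I, one_mul]
    exact norm_cexp_mul_le f v ((Complex.abs_re_le_norm z).trans hz) x

end SuperExpDecay

end ExpFourier

/-! ### L² norms by duality. -/

section Duality

variable {n : ℕ}

theorem enorm_integral_mul_le_eLpNorm_mul {F g : Rn n → ℂ} (hF : AEStronglyMeasurable F)
    (hg : AEStronglyMeasurable g) :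
    ‖∫ ξ, F ξ * g ξ‖ₑ ≤ eLpNorm F 2 * eLpNorm g 2 := by
  refine (enorm_integral_le_lintegral_enorm _).trans ?_
  rw [← eLpNorm_one_eq_lintegral_enorm]
  have h := eLpNorm_smul_le_mul_eLpNorm (p := 2) (q := 2) (r := 1) hg hF
  simpa only [smul_eq_mul, Pi.mul_def] using h

theorem eLpNorm_two_sq_eq_lintegral {X : Type*} [MeasurableSpace X] {μ : Measure X} (f : X → ℂ) :
    eLpNorm f 2 μ ^ 2 = ∫⁻ x, ‖f x‖ₑ ^ 2 ∂μ := by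
  rw [eLpNorm_eq_lintegral_rpow_enorm_toReal two_ne_zero ENNReal.ofNat_ne_top,
    ← ENNReal.rpow_natCast, ← ENNReal.rpow_mul]
  simp

open Filter Topology in
/-- `L²` duality against bounded-support functions. -/
theorem eLpNorm_le_of_enorm_integral_mul_le {h : Rn n → ℂ} (hc : Continuous h) {C : ℝ≥0∞}
    (H : ∀ (R : ℝ) (g : Rn n → ℂ), Integrable g → MemLp g 2 → (∀ ξ, R < ‖ξ‖ → g ξ = 0) →
      ‖∫ ξ, h ξ * g ξ‖ₑ ≤ C * eLpNorm g 2) : eLpNorm h 2 ≤ C := by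
  set B : ℕ → Set (Rn n) := fun k => Metric.closedBall 0 k
  have hB : ∀ k, MeasurableSet (B k) := fun k => measurableSet_closedBall
  have hfin : ∀ k, IsFiniteMeasure (volume.restrict (B k)) := fun k =>
    ⟨by rw [Measure.restrict_apply_univ]; exact measure_closedBall_lt_top⟩
  have hbound : ∀ k, eLpNorm ((B k).indicator h) 2 ≤ C := by
    intro k
    obtain ⟨M, hM⟩ := (isCompact_closedBall (0 : Rn n) k).exists_bound_of_continuousOn
      hc.continuousOn
    have hmem : ∀ p : ℝ≥0∞, MemLp ((B k).indicator (fun ξ => (starRingEnd ℂ) (h ξ))) p := by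
      intro p
      have := hfin k
      rw [memLp_indicator_iff_restrict (hB k)]
      refine MemLp.of_bound (by fun_prop) M ?_
      filter_upwards [ae_restrict_mem (hB k)] with ξ hξ
      simpa using hM ξ hξ
    have hmem' : MemLp ((B k).indicator h) 2 := by
      refine (hmem 2).congr_norm (hc.aestronglyMeasurable.indicator (hB k))
        (ae_of_all _ fun ξ => ?_)
      by_cases hξ : ξ ∈ B k <;> simp [hξ]
    have hnorm : eLpNorm ((B k).indicator (fun ξ => (starRingEnd ℂ) (h ξ))) 2
        = eLpNorm ((B k).indicator h) 2 :=
      eLpNorm_congr_norm_ae (ae_of_all _ fun ξ => by by_cases hξ : ξ ∈ B k <;> simp [hξ])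
    -- The test function is the conjugate of h cut off to a ball. The pairing is then the square of
    -- the truncated norm, and one finite factor can be cancelled.
    have h1 := H k _ (memLp_one_iff_integrable.1 (hmem 1)) (hmem 2) (fun ξ hξ => by
      have : ξ ∉ B k := by simpa [B] using hξ
      simp [this])
    have h2 : ‖∫ ξ, h ξ * (B k).indicator (fun ξ => (starRingEnd ℂ) (h ξ)) ξ‖ₑ
        = eLpNorm ((B k).indicator h) 2 * eLpNorm ((B k).indicator h) 2 := by
      have h3 : ∀ ξ, h ξ * (B k).indicator (fun ξ => (starRingEnd ℂ) (h ξ)) ξ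
          = ((‖(B k).indicator h ξ‖ ^ 2 : ℝ) : ℂ) := fun ξ => by
        by_cases hξ : ξ ∈ B k
        · simp [hξ, Complex.mul_conj, Complex.normSq_eq_norm_sq]
        · simp [hξ]
      simp only [h3]
      rw [integral_complex_ofReal, ← ofReal_norm, Complex.norm_real,
        Real.norm_of_nonneg (integral_nonneg fun ξ => sq_nonneg _),
        ofReal_integral_eq_lintegral_ofReal ((memLp_two_iff_integrable_sq_norm hmem'.1).1 hmem')
          (ae_of_all _ fun ξ => sq_nonneg _), ← sq,
        eLpNorm_two_sq_eq_lintegral]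
      simp [ENNReal.ofReal_pow]
    rw [h2, hnorm] at h1
    by_cases h0 : eLpNorm ((B k).indicator h) 2 = 0
    · simp [h0]
    exact (ENNReal.mul_le_mul_iff_left h0 hmem'.2.ne).1 h1
  refine Lp.eLpNorm_le_of_ae_tendsto (u := atTop) (f := fun k => (B k).indicator h)
    (Eventually.of_forall hbound) (fun k => hc.aestronglyMeasurable.indicator (hB k))
    (ae_of_all _ fun ξ => ?_)
  refine tendsto_const_nhds.congr' ?_
  obtain ⟨K, hK⟩ := exists_nat_ge ‖ξ‖
  filter_upwards [eventually_ge_atTop K] with k hk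
  have : ξ ∈ B k := by
    simp only [B, mem_closedBall_zero_iff]
    exact hK.trans (by exact_mod_cast hk)
  simp [this]

end Duality

/-! ### Log-convexity by the three lines theorem. -/

section Convexity

variable {n : ℕ}

/-- The pairing of a weighted Fourier-Laplace transform with a test function, holomorphic in the
weights. -/
noncomputable def weightPairing (f : Rn n → ℂ) (v : Rn n) (g : Rn n → ℂ) (p q : ℂ) : ℂ :=
  ∫ ξ, Complex.exp (q * (inner ℝ v ξ : ℝ)) * expFourier f v p ξ * g ξ

theorem expWeightNorm_comp_sub (f : Rn n → ℂ) (hf : Continuous f) (v w : Rn n) (q : ℝ) :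
    expWeightNorm (fun ξ => q * inner ℝ v ξ) (fun ξ => f (ξ - w))
      = ENNReal.ofReal (Real.exp (q * inner ℝ v w)) *
        expWeightNorm (fun ξ => q * inner ℝ v ξ) f := by
  have h1 : (fun ξ => (Real.exp (q * inner ℝ v ξ) : ℂ) * f (ξ - w))
      = (Real.exp (q * inner ℝ v w) : ℂ) •
        ((fun ξ => (Real.exp (q * inner ℝ v ξ) : ℂ) * f ξ) ∘ fun ξ => ξ - w) := by
    ext ξ
    simp only [Pi.smul_apply, Function.comp_apply, smul_eq_mul]
    rw [← mul_assoc, ← Complex.ofReal_mul, ← Real.exp_add, inner_sub_right]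
    ring_nf
  rw [expWeightNorm, h1, eLpNorm_const_smul, eLpNorm_comp_measurePreserving
    (Continuous.aestronglyMeasurable (by fun_prop)) (measurePreserving_sub_right volume w),
    expWeightNorm, ← ofReal_norm, Complex.norm_real, Real.norm_of_nonneg (Real.exp_pos _).le]

variable {f : Rn n → ℂ}

/-- On a vertical line y' contributes only a phase, while y translates the transform by (y/2π)v;
undoing this translation in the weight costs the exponential factor. -/
theorem SuperExpDecay.enorm_weightPairing_le (hf : SuperExpDecay f) (v : Rn n) {g : Rn n → ℂ}
    (hg : AEStronglyMeasurable g) (p q y y' : ℝ) :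
    ‖weightPairing f v g (p + y * Complex.I) (q + y' * Complex.I)‖ₑ ≤
      ENNReal.ofReal (Real.exp (q * (y / (2 * Real.pi)) * ‖v‖ ^ 2)) *
        expWeightNorm (fun ξ => q * inner ℝ v ξ) (expFourier f v p) * eLpNorm g 2 := by
  have hc := hf.continuous_expFourier v p
  have hc' := hf.continuous_expFourier v (p + y * Complex.I)
  refine (enorm_integral_mul_le_eLpNorm_mul
    (Continuous.aestronglyMeasurable (by fun_prop)) hg).trans ?_
  gcongr
  have h1 := expWeightNorm_comp_sub (expFourier f v p) hc v ((y / (2 * Real.pi)) • v) q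
  rw [inner_smul_right, real_inner_self_eq_norm_sq, ← mul_assoc] at h1
  rw [← h1, expWeightNorm]
  refine le_of_eq (eLpNorm_congr_norm_ae (ae_of_all _ fun ξ => ?_))
  rw [norm_mul, norm_mul, expFourier_add_mul_I, Complex.norm_exp, Complex.norm_real,
    Real.norm_of_nonneg (Real.exp_pos _).le]
  simp

theorem SuperExpDecay.norm_weightPairing_integrand_le {C Q R : ℝ} (v : Rn n)
    {g : Rn n → ℂ} (hg : ∀ ξ, R < ‖ξ‖ → g ξ = 0) {p q : ℂ} (hq : |q.re| ≤ Q) {ξ : Rn n}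
    (hC : ‖expFourier f v p ξ‖ ≤ C) :
    ‖Complex.exp (q * (inner ℝ v ξ : ℝ)) * expFourier f v p ξ * g ξ‖
      ≤ Real.exp (Q * (‖v‖ * R)) * C * ‖g ξ‖ := by
  rw [norm_mul, norm_mul]
  by_cases hξ : R < ‖ξ‖
  · simp [hg ξ hξ]
  gcongr
  rw [Complex.norm_exp, Complex.re_mul_ofReal]
  refine Real.exp_le_exp.2 ((le_abs_self _).trans ?_)
  rw [abs_mul]
  refine mul_le_mul hq ((abs_real_inner_le_norm v ξ).trans ?_) (abs_nonneg _)
    ((abs_nonneg _).trans hq)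
  gcongr
  exact not_lt.1 hξ

theorem SuperExpDecay.exists_norm_weightPairing_le (hf : SuperExpDecay f) (v : Rn n)
    {g : Rn n → ℂ} {R : ℝ} (hgi : Integrable g) (hg : ∀ ξ, R < ‖ξ‖ → g ξ = 0) (Q : ℝ) :
    ∃ K : ℝ, 0 ≤ K ∧ ∀ p q : ℂ, |p.re| ≤ Q → |q.re| ≤ Q → ‖weightPairing f v g p q‖ ≤ K := by
  obtain ⟨C, hC0, hC⟩ := hf.exists_norm_expFourier_le v Q
  refine ⟨∫ ξ, Real.exp (Q * (‖v‖ * R)) * C * ‖g ξ‖, by positivity, fun p q hp hq => ?_⟩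
  exact norm_integral_le_of_norm_le (hgi.norm.const_mul _) (ae_of_all _ fun ξ =>
    norm_weightPairing_integrand_le v hg hq (hC p hp ξ))

theorem SuperExpDecay.differentiable_weightPairing (hf : SuperExpDecay f) (v : Rn n)
    {g : Rn n → ℂ} {R : ℝ} (hgi : Integrable g) (hg : ∀ ξ, R < ‖ξ‖ → g ξ = 0)
    (p₀ q₀ δp δq : ℂ) :
    Differentiable ℂ (fun z => weightPairing f v g (p₀ + z * δp) (q₀ + z * δq)) := by
  refine differentiable_integral_of_dominated (fun z => ?_) (fun ξ => ?_) (fun r => ?_)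
  · have hc' := hf.continuous_expFourier v (p₀ + z * δp)
    exact (Continuous.aestronglyMeasurable (by fun_prop)).mul hgi.1
  · have h1 : Differentiable ℂ (fun z : ℂ => expFourier f v (p₀ + z * δp) ξ) :=
      (hf.differentiable_expFourier v ξ).comp (by fun_prop)
    fun_prop
  · obtain ⟨C, hC0, hC⟩ := hf.exists_norm_expFourier_le v (‖p₀‖ + r * ‖δp‖)
    have key : ∀ a d z : ℂ, ‖z‖ ≤ r → |(a + z * d).re| ≤ ‖a‖ + r * ‖d‖ := fun a d z hz => by
      refine (Complex.abs_re_le_norm _).trans ((norm_add_le _ _).trans ?_)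
      rw [norm_mul]
      gcongr
    exact ⟨_, hgi.norm.const_mul _, fun z hz ξ => norm_weightPairing_integrand_le v hg
      (key q₀ δq z hz) (hC _ (key p₀ δp z hz) ξ)⟩

/-- Hadamard's three lines theorem for an entire function bounded on the strip `0 ≤ Re z ≤ 1`. -/
theorem norm_le_rpow_mul_rpow_of_strip {G : ℂ → ℂ} (hG : Differentiable ℂ G) {K a b θ : ℝ}
    (hθ : θ ∈ Icc (0 : ℝ) 1) (hK : ∀ z : ℂ, z.re ∈ Icc (0 : ℝ) 1 → ‖G z‖ ≤ K)
    (ha : ∀ z : ℂ, z.re = 0 → ‖G z‖ ≤ a) (hb : ∀ z : ℂ, z.re = 1 → ‖G z‖ ≤ b) :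
    ‖G θ‖ ≤ a ^ (1 - θ) * b ^ θ := by
  have hz : (θ : ℂ) ∈ Complex.HadamardThreeLines.verticalClosedStrip 0 1 := by
    rw [Complex.HadamardThreeLines.verticalClosedStrip, mem_preimage, Complex.ofReal_re]
    exact hθ
  have hbdd : BddAbove ((norm ∘ G) '' Complex.HadamardThreeLines.verticalClosedStrip 0 1) :=
    ⟨K, by rintro _ ⟨z, hz, rfl⟩; exact hK z hz⟩
  have h := Complex.HadamardThreeLines.norm_le_interp_of_mem_verticalClosedStrip₀₁' G hz
    hG.diffContOnCl hbdd (fun z hz => ha z (mem_singleton_iff.1 hz))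
    (fun z hz => hb z (mem_singleton_iff.1 hz))
  rwa [Complex.ofReal_re] at h

theorem mul_le_of_norm_le_exp_mul {a b c X Y : ℝ} (hc : 0 ≤ c) (ha : a ≤ Real.exp X * c)
    (hb : b = Real.exp Y) (h : X + Y ≤ 0) : a * b ≤ c := by
  rw [hb]
  calc a * Real.exp Y ≤ Real.exp X * c * Real.exp Y :=
        mul_le_mul_of_nonneg_right ha (Real.exp_pos _).le
    _ = Real.exp (X + Y) * c := by rw [Real.exp_add]; ring
    _ ≤ 1 * c := mul_le_mul_of_nonneg_right (Real.exp_le_one_iff.2 h) hc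
    _ = c := one_mul c

-- Both weights move affinely in z. The three lines theorem is applied not to the pairing itself but
-- to its product with an entire function that removes the growth caused by the frequency
-- translation.
open Filter Topology in
theorem SuperExpDecay.norm_weightPairing_interp_le (hf : SuperExpDecay f) (v : Rn n)
    {g : Rn n → ℂ} {R : ℝ} (hgi : Integrable g) (hg2 : MemLp g 2)
    (hg : ∀ ξ, R < ‖ξ‖ → g ξ = 0) (p₀ q₀ δp δq : ℝ) {θ : ℝ} (hθ : θ ∈ Icc (0 : ℝ) 1)
    (h₀ : expWeightNorm (fun ξ => q₀ * inner ℝ v ξ) (expFourier f v p₀) ≠ ∞)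
    (h₁ : expWeightNorm (fun ξ => (q₀ + δq) * inner ℝ v ξ)
      (expFourier f v ((p₀ + δp : ℝ) : ℂ)) ≠ ∞) :
    ‖weightPairing f v g (p₀ + θ * δp) (q₀ + θ * δq)‖ ≤
      ((expWeightNorm (fun ξ => q₀ * inner ℝ v ξ) (expFourier f v p₀)).toReal *
        (eLpNorm g 2).toReal) ^ (1 - θ) *
      ((expWeightNorm (fun ξ => (q₀ + δq) * inner ℝ v ξ)
        (expFourier f v ((p₀ + δp : ℝ) : ℂ))).toReal * (eLpNorm g 2).toReal) ^ θ := by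
  set Λ₀ := expWeightNorm (fun ξ => q₀ * inner ℝ v ξ) (expFourier f v p₀) with hΛ₀
  set Λ₁ := expWeightNorm (fun ξ => (q₀ + δq) * inner ℝ v ξ)
      (expFourier f v ((p₀ + δp : ℝ) : ℂ)) with hΛ₁
  set H : ℂ → ℂ := fun z => weightPairing f v g (p₀ + z * δp) (q₀ + z * δq) with hH
  have hHd : Differentiable ℂ H := hf.differentiable_weightPairing v hgi hg _ _ _ _
  set κ : ℝ := δp * ‖v‖ ^ 2 / (2 * Real.pi) with hκ
  -- On Re z = s the quadratic phase has modulus exp(-κ(q₀ + sδq) Im z), exactly inverse to the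
  -- growth of `H` coming from the translation; on the real axis it is unimodular. The factor
  -- e^{ε(z²-1)} has modulus at most 1 on the strip and forces boundedness there; ε tends to 0 at
  -- the end.
  set E : ℝ → ℂ → ℂ := fun ε z => Complex.exp (Complex.I * (κ * (q₀ * z + δq * z ^ 2 / 2))
    + ε * (z ^ 2 - 1)) with hE
  have hEnorm : ∀ ε z, ‖E ε z‖ = Real.exp (-(κ * (q₀ + δq * z.re) * z.im)
      + ε * (z.re ^ 2 - z.im ^ 2 - 1)) := fun ε z => by
    rw [hE, Complex.norm_exp]
    congr 1
    have e1 : (δq * z ^ 2 / 2 : ℂ) = ((δq / 2 : ℝ) : ℂ) * z ^ 2 := by push_cast; ring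
    rw [e1]
    simp only [Complex.add_re, Complex.mul_re, Complex.I_re, Complex.I_im, Complex.ofReal_re,
      Complex.ofReal_im, Complex.mul_im, Complex.add_im, Complex.sub_re, Complex.one_re, sq]
    ring
  have hbd : ∀ s y : ℝ, ∀ Λ : ℝ≥0∞, Λ ≠ ∞ →
      expWeightNorm (fun ξ => (q₀ + s * δq) * inner ℝ v ξ)
        (expFourier f v ((p₀ + s * δp : ℝ) : ℂ)) = Λ →
      ‖H (s + y * Complex.I)‖ ≤
        Real.exp (κ * (q₀ + δq * s) * y) * (Λ.toReal * (eLpNorm g 2).toReal) := by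
    intro s y Λ hΛ hs
    have h := hf.enorm_weightPairing_le v hgi.1 (p₀ + s * δp) (q₀ + s * δq) (y * δp) (y * δq)
    rw [hs] at h
    have h2 := ENNReal.toReal_mono (by finiteness) h
    rw [toReal_enorm, ENNReal.toReal_mul, ENNReal.toReal_mul,
      ENNReal.toReal_ofReal (Real.exp_pos _).le, mul_assoc] at h2
    have e1 : H (s + y * Complex.I) = weightPairing f v g (((p₀ + s * δp : ℝ) : ℂ)
        + ((y * δp : ℝ) : ℂ) * Complex.I) (((q₀ + s * δq : ℝ) : ℂ)
        + ((y * δq : ℝ) : ℂ) * Complex.I) := by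
      simp only [hH]; push_cast; congr 1 <;> ring
    have e2 : κ * (q₀ + δq * s) * y = (q₀ + s * δq) * (y * δp / (2 * Real.pi)) * ‖v‖ ^ 2 := by
      rw [hκ]; field_simp
    rw [e1, e2]
    exact h2
  obtain ⟨K, hK0, hK⟩ := hf.exists_norm_weightPairing_le v hgi hg
    (|p₀| + |δp| + (|q₀| + |δq|))
  have hstrip : ∀ z : ℂ, z.re ∈ Icc (0 : ℝ) 1 → ‖H z‖ ≤ K := by
    intro z hz
    have hz' : |z.re| ≤ 1 := by rw [abs_of_nonneg hz.1]; exact hz.2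
    have key : ∀ a d : ℝ, |((a : ℂ) + z * d).re| ≤ |a| + |d| := fun a d => by
      rw [Complex.add_re, Complex.ofReal_re, Complex.re_mul_ofReal]
      refine (abs_add_le _ _).trans ?_
      rw [abs_mul]
      nlinarith [abs_nonneg d]
    refine hK _ _ ((key _ _).trans ?_) ((key _ _).trans ?_)
    · have := abs_nonneg q₀; have := abs_nonneg δq; linarith
    · have := abs_nonneg p₀; have := abs_nonneg δp; linarith
  have hleft : ∀ ε z, 0 < ε → z.re = 0 → ‖H z * E ε z‖ ≤ Λ₀.toReal * (eLpNorm g 2).toReal := by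
    intro ε z hε hz
    have h := hbd 0 z.im Λ₀ h₀ (by simp [hΛ₀])
    have hzz : ((0 : ℝ) : ℂ) + z.im * Complex.I = z := Complex.ext (by simp [hz]) (by simp)
    rw [hzz] at h
    rw [norm_mul]
    refine mul_le_of_norm_le_exp_mul (by positivity) h (hEnorm ε z) ?_
    rw [hz]
    nlinarith [mul_nonneg hε.le (sq_nonneg z.im)]
  have hright : ∀ ε z, 0 < ε → z.re = 1 → ‖H z * E ε z‖ ≤ Λ₁.toReal * (eLpNorm g 2).toReal := by
    intro ε z hε hz
    have h := hbd 1 z.im Λ₁ h₁ (by simp [hΛ₁])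
    have hzz : ((1 : ℝ) : ℂ) + z.im * Complex.I = z := Complex.ext (by simp [hz]) (by simp)
    rw [hzz] at h
    rw [norm_mul]
    refine mul_le_of_norm_le_exp_mul (by positivity) h (hEnorm ε z) ?_
    rw [hz]
    nlinarith [mul_nonneg hε.le (sq_nonneg z.im)]
  -- Inside the strip `H` is bounded and the phase grows at most like e^{Q|y|}; the exponent Q²/(4ε)
  -- is the maximum of Q|y| - εy².
  have hbdd : ∀ ε z, 0 < ε → z.re ∈ Icc (0 : ℝ) 1 → ‖H z * E ε z‖ ≤
      K * Real.exp ((|κ| * (|q₀| + |δq|)) ^ 2 / (4 * ε)) := by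
    intro ε z hε hz
    set Q := |κ| * (|q₀| + |δq|) with hQ
    rw [norm_mul, hEnorm]
    refine mul_le_mul (hstrip z hz) (Real.exp_le_exp.2 ?_) (Real.exp_pos _).le hK0
    have h1 : -(κ * (q₀ + δq * z.re) * z.im) ≤ Q * |z.im| := by
      refine (neg_le_abs _).trans ?_
      rw [abs_mul, abs_mul, hQ]
      gcongr
      refine (abs_add_le _ _).trans ?_
      rw [abs_mul, abs_of_nonneg hz.1]
      nlinarith [abs_nonneg δq, hz.2]
    have h2 : ε * (z.re ^ 2 - z.im ^ 2 - 1) ≤ -(ε * |z.im| ^ 2) := by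
      rw [sq_abs]
      nlinarith [hz.1, hz.2, mul_nonneg hε.le (by nlinarith [hz.1, hz.2] : 0 ≤ 1 - z.re ^ 2)]
    have h3 : Q ^ 2 / (4 * ε) - (Q * |z.im| - ε * |z.im| ^ 2)
        = (Q - 2 * ε * |z.im|) ^ 2 / (4 * ε) := by field_simp; ring
    have h4 : 0 ≤ (Q - 2 * ε * |z.im|) ^ 2 / (4 * ε) := by positivity
    linarith
  have hEd : ∀ ε, Differentiable ℂ (E ε) := fun ε => by simp only [hE]; fun_prop
  have hinterp : ∀ ε : ℝ, 0 < ε → ‖H θ * E ε θ‖ ≤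
      (Λ₀.toReal * (eLpNorm g 2).toReal) ^ (1 - θ) *
      (Λ₁.toReal * (eLpNorm g 2).toReal) ^ θ := by
    intro ε hε
    exact norm_le_rpow_mul_rpow_of_strip (hHd.mul (hEd ε)) hθ (fun z => hbdd ε z hε)
      (fun z => hleft ε z hε) (fun z => hright ε z hε)
  have h1 : Continuous (fun ε : ℝ => ‖H θ‖ * ‖E ε θ‖) := by
    simp only [hEnorm]; fun_prop
  have h2 : ‖E 0 θ‖ = 1 := by rw [hEnorm]; simp
  have h3 : Tendsto (fun ε : ℝ => ‖H θ‖ * ‖E ε θ‖) (𝓝[>] 0) (𝓝 (‖H θ‖ * ‖E 0 θ‖)) :=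
    (h1.tendsto 0).mono_left nhdsWithin_le_nhds
  rw [h2, mul_one] at h3
  refine le_of_tendsto h3 ?_
  filter_upwards [self_mem_nhdsWithin] with ε hε
  rw [← norm_mul]
  exact hinterp ε hε

/-- Log-convexity of the weighted norms of the Fourier-Laplace transform. -/
theorem SuperExpDecay.expWeightNorm_expFourier_interp_le (hf : SuperExpDecay f) (v : Rn n)
    (p₀ q₀ δp δq : ℝ) {θ : ℝ} (hθ : θ ∈ Icc (0 : ℝ) 1)
    (h₀ : expWeightNorm (fun ξ => q₀ * inner ℝ v ξ) (expFourier f v p₀) ≠ ∞)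
    (h₁ : expWeightNorm (fun ξ => (q₀ + δq) * inner ℝ v ξ)
      (expFourier f v ((p₀ + δp : ℝ) : ℂ)) ≠ ∞) :
    expWeightNorm (fun ξ => (q₀ + θ * δq) * inner ℝ v ξ)
        (expFourier f v ((p₀ + θ * δp : ℝ) : ℂ)) ≤
      expWeightNorm (fun ξ => q₀ * inner ℝ v ξ) (expFourier f v p₀) ^ (1 - θ) *
      expWeightNorm (fun ξ => (q₀ + δq) * inner ℝ v ξ)
        (expFourier f v ((p₀ + δp : ℝ) : ℂ)) ^ θ := by
  have hc := hf.continuous_expFourier v ((p₀ + θ * δp : ℝ) : ℂ)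
  refine eLpNorm_le_of_enorm_integral_mul_le (by fun_prop) fun R g hgi hg2 hg => ?_
  have h := hf.norm_weightPairing_interp_le v hgi hg2 hg p₀ q₀ δp δq hθ h₀ h₁
  set Λ₀ := expWeightNorm (fun ξ => q₀ * inner ℝ v ξ) (expFourier f v p₀)
  set Λ₁ := expWeightNorm (fun ξ => (q₀ + δq) * inner ℝ v ξ)
      (expFourier f v ((p₀ + δp : ℝ) : ℂ))
  have hθ' : 0 ≤ 1 - θ := sub_nonneg.2 hθ.2
  -- The powers 1 - θ and θ of the norm of g recombine to its first power, as duality requires.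
  rw [Real.mul_rpow ENNReal.toReal_nonneg ENNReal.toReal_nonneg,
    Real.mul_rpow ENNReal.toReal_nonneg ENNReal.toReal_nonneg, mul_mul_mul_comm,
    ← Real.rpow_add' ENNReal.toReal_nonneg (by simp), sub_add_cancel, Real.rpow_one,
    ENNReal.toReal_rpow, ENNReal.toReal_rpow, ← ENNReal.toReal_mul, ← ENNReal.toReal_mul] at h
  have hfin : Λ₀ ^ (1 - θ) * Λ₁ ^ θ * eLpNorm g 2 ≠ ∞ :=
    ENNReal.mul_ne_top (ENNReal.mul_ne_top (ENNReal.rpow_ne_top_of_nonneg hθ' h₀)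
      (ENNReal.rpow_ne_top_of_nonneg hθ.1 h₁)) hg2.2.ne
  have h' := ENNReal.ofReal_le_ofReal h
  rw [ENNReal.ofReal_toReal hfin, ofReal_norm] at h'
  refine le_of_eq_of_le ?_ h'
  congr 1
  refine integral_congr_ae (ae_of_all _ fun ξ => ?_)
  simp only
  push_cast
  rfl

end Convexity

/-! ### The Schrödinger multiplier at complex frequencies. -/

open Filter Topology in
/-- Entire functions that agree on the imaginary axis are equal. -/
theorem Differentiable.eq_of_eq_mul_I {A B : ℂ → ℂ} (hA : Differentiable ℂ A)
    (hB : Differentiable ℂ B) (h : ∀ y : ℝ, A (y * Complex.I) = B (y * Complex.I)) : A = B := by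
  refine AnalyticOnNhd.eq_of_frequently_eq (z₀ := 0)
    (fun z _ => hA.analyticAt z) (fun z _ => hB.analyticAt z) ?_
  have h1 : Tendsto (fun y : ℝ => (y : ℂ) * Complex.I) (𝓝[≠] 0) (𝓝[≠] 0) := by
    refine tendsto_nhdsWithin_iff.2 ⟨?_, ?_⟩
    · have h2 : Continuous (fun y : ℝ => (y : ℂ) * Complex.I) := by fun_prop
      simpa using (h2.tendsto 0).mono_left (nhdsWithin_le_nhds (s := {0}ᶜ))
    · filter_upwards [self_mem_nhdsWithin] with y hy
      simpa using hy
  exact h1.frequently (Frequently.of_forall h)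

section GaussianMultiplier

variable {n : ℕ}

/-- The holomorphic extension of `y ↦ ‖ξ - (y/2π) v‖²` to `z = iy`. -/
noncomputable def complexNormSq (v ξ : Rn n) (z : ℂ) : ℂ :=
  (‖ξ‖ ^ 2 : ℝ) + z * Complex.I / Real.pi * (inner ℝ v ξ : ℝ)
    - z ^ 2 * ((‖v‖ ^ 2 / (4 * Real.pi ^ 2) : ℝ) : ℂ)

theorem complexNormSq_mul_I (v ξ : Rn n) (y : ℝ) :
    complexNormSq v ξ (y * Complex.I) = ((‖ξ - (y / (2 * Real.pi)) • v‖ ^ 2 : ℝ) : ℂ) := by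
  rw [norm_sub_sq_real, inner_smul_right, norm_smul, mul_pow, Real.norm_eq_abs, sq_abs,
    real_inner_comm v ξ, complexNormSq]
  have : (Real.pi : ℂ) ≠ 0 := by exact_mod_cast Real.pi_ne_zero
  push_cast
  field_simp
  linear_combination (16 * (Real.pi : ℂ) * y * inner ℝ v ξ - 4 * y ^ 2 * ‖v‖ ^ 2) * Complex.I_sq

theorem complexNormSq_zero (v ξ : Rn n) : complexNormSq v ξ 0 = ((‖ξ‖ ^ 2 : ℝ) : ℂ) := by
  simp [complexNormSq]

theorem differentiable_complexNormSq (v ξ : Rn n) : Differentiable ℂ (complexNormSq v ξ) := by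
  unfold complexNormSq
  fun_prop

theorem continuous_complexNormSq (v : Rn n) (z : ℂ) :
    Continuous (fun ξ => complexNormSq v ξ z) := by
  unfold complexNormSq
  fun_prop

/-- At real p the cross term of the complexified square is purely imaginary, so the oscillating
factor iτ turns it into a real linear weight in ξ, while ε retains Gaussian damping. -/
theorem re_mul_complexNormSq (v ξ : Rn n) (ε τ p : ℝ) :
    (-((ε + τ * Complex.I) * complexNormSq v ξ p)).re =
      τ * p / Real.pi * inner ℝ v ξ - ε * (‖ξ‖ ^ 2 - p ^ 2 * (‖v‖ ^ 2 / (4 * Real.pi ^ 2))) := by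
  have h : complexNormSq v ξ p
      = ((‖ξ‖ ^ 2 - p ^ 2 * (‖v‖ ^ 2 / (4 * Real.pi ^ 2)) : ℝ) : ℂ)
        + ((p / Real.pi * inner ℝ v ξ : ℝ) : ℂ) * Complex.I := by
    rw [complexNormSq]; push_cast; ring
  rw [h, show τ * p / Real.pi * inner ℝ v ξ = τ * (p / Real.pi * inner ℝ v ξ) by ring]
  generalize ‖ξ‖ ^ 2 - p ^ 2 * (‖v‖ ^ 2 / (4 * Real.pi ^ 2)) = a
  generalize p / Real.pi * inner ℝ v ξ = b
  simp

theorem norm_exp_mul_complexNormSq_le (v ξ : Rn n) (ε τ : ℝ) {R : ℝ}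
    {z : ℂ} (hz : ‖z‖ ≤ R) :
    ‖Complex.exp (-((ε + τ * Complex.I) * complexNormSq v ξ z))‖ ≤
      Real.exp (‖ε + τ * Complex.I‖ * (R ^ 2 * (‖v‖ ^ 2 / (4 * Real.pi ^ 2)))) *
      Real.exp (‖ε + τ * Complex.I‖ * (R / Real.pi * ‖v‖) * ‖ξ‖ - ε * ‖ξ‖ ^ 2) := by
  rw [Complex.norm_exp, ← Real.exp_add]
  refine Real.exp_le_exp.2 ?_
  set σ : ℂ := ε + τ * Complex.I with hσ
  set d : ℂ := z * Complex.I / Real.pi * (inner ℝ v ξ : ℝ)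
    - z ^ 2 * ((‖v‖ ^ 2 / (4 * Real.pi ^ 2) : ℝ) : ℂ) with hd
  have hR : 0 ≤ R := (norm_nonneg z).trans hz
  have h1 : (-(σ * complexNormSq v ξ z)).re = -(ε * ‖ξ‖ ^ 2) + (-(σ * d)).re := by
    have : -(σ * complexNormSq v ξ z) = -(σ * ((‖ξ‖ ^ 2 : ℝ) : ℂ)) + -(σ * d) := by
      rw [complexNormSq, hd]; ring
    rw [this, Complex.add_re, Complex.neg_re, Complex.re_mul_ofReal, hσ]
    simp
  have h2 : ‖d‖ ≤ R / Real.pi * (‖v‖ * ‖ξ‖) + R ^ 2 * (‖v‖ ^ 2 / (4 * Real.pi ^ 2)) := by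
    refine (norm_sub_le _ _).trans ?_
    rw [norm_mul, norm_mul, norm_div, norm_mul, Complex.norm_I, mul_one, norm_pow,
      Complex.norm_real, Complex.norm_real, Complex.norm_real,
      Real.norm_of_nonneg Real.pi_pos.le, Real.norm_of_nonneg (by positivity : 0 ≤ ‖v‖ ^ 2 / (4 * Real.pi ^ 2))]
    have := abs_real_inner_le_norm v ξ
    have hpi := Real.pi_pos
    rw [← Real.norm_eq_abs] at this
    gcongr
  have h3 : (-(σ * d)).re ≤ ‖σ‖ * ‖d‖ := by
    refine (Complex.re_le_norm _).trans ?_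
    rw [norm_neg, norm_mul]
  have h4 := mul_le_mul_of_nonneg_left h2 (norm_nonneg σ)
  rw [h1]
  nlinarith

variable {f : Rn n → ℂ}

/-- If `g` evolves from `f` by the free Schrödinger flow, then so do their Fourier-Laplace
transforms. -/
theorem SuperExpDecay.expFourier_eq_of_fourier_eq {g : Rn n → ℂ} (hf : SuperExpDecay f)
    (hg : SuperExpDecay g) {τ : ℝ}
    (h : ∀ᵐ ξ, 𝓕 g ξ = Complex.exp (-(τ * Complex.I * (‖ξ‖ ^ 2 : ℝ))) * 𝓕 f ξ)
    (v ξ : Rn n) (z : ℂ) :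
    expFourier g v z ξ =
      Complex.exp (-(τ * Complex.I * complexNormSq v ξ z)) * expFourier f v z ξ := by
  have hfc := hf.continuous_expFourier 0 0
  have hgc := hg.continuous_expFourier 0 0
  rw [expFourier_zero] at hfc hgc
  have h' : ∀ ξ, 𝓕 g ξ = Complex.exp (-(τ * Complex.I * (‖ξ‖ ^ 2 : ℝ))) * 𝓕 f ξ :=
    fun ξ => congrFun (hgc.ae_eq_iff_eq volume (by fun_prop) |>.1 h) ξ
  have hd := differentiable_complexNormSq v ξ
  refine congrFun (Differentiable.eq_of_eq_mul_I
    (A := fun z => expFourier g v z ξ)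
    (B := fun z => Complex.exp (-(τ * Complex.I * complexNormSq v ξ z)) * expFourier f v z ξ)
    (hg.differentiable_expFourier v ξ)
    ((by fun_prop : Differentiable ℂ fun z =>
      Complex.exp (-(τ * Complex.I * complexNormSq v ξ z))).mul
      (hf.differentiable_expFourier v ξ)) fun y => ?_) z
  have e := expFourier_add_mul_I f v 0 y ξ
  have e' := expFourier_add_mul_I g v 0 y ξ
  rw [zero_add, expFourier_zero] at e e'
  rw [e, e', complexNormSq_mul_I, h']

/-- Plancherel for e^{p v·x} g, combined with the modulus of the continued multiplier at z = p. -/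
theorem SuperExpDecay.expWeightNorm_expFourier_eq {g : Rn n → ℂ} (hf : SuperExpDecay f)
    (hg : SuperExpDecay g) {τ : ℝ}
    (h : ∀ᵐ ξ, 𝓕 g ξ = Complex.exp (-(τ * Complex.I * (‖ξ‖ ^ 2 : ℝ))) * 𝓕 f ξ)
    (v : Rn n) (p : ℝ) :
    expWeightNorm (fun ξ => τ * p / Real.pi * inner ℝ v ξ) (expFourier f v p)
      = expWeightNorm (fun x => p * inner ℝ v x) g := by
  have h1 := hg.eLpNorm_expFourier v p
  have h2 : (fun x => Complex.exp ((p : ℂ) * (inner ℝ v x : ℝ)) * g x)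
      = fun x => (Real.exp (p * inner ℝ v x) : ℂ) * g x := by
    ext x; push_cast; rfl
  rw [h2] at h1
  rw [expWeightNorm, expWeightNorm, ← h1]
  refine eLpNorm_congr_norm_ae (ae_of_all _ fun ξ => ?_)
  rw [hf.expFourier_eq_of_fourier_eq hg h, norm_mul, norm_mul, Complex.norm_real,
    Real.norm_of_nonneg (Real.exp_pos _).le, Complex.norm_exp]
  have := re_mul_complexNormSq v ξ 0 τ p
  simp only [Complex.ofReal_zero, zero_add, zero_mul, sub_zero] at this
  rw [this]

theorem norm_exp_inner_sub (x ξ v : Rn n) (z : ℂ) :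
    ‖Complex.exp (((2 * Real.pi * inner ℝ x ξ : ℝ) : ℂ) * Complex.I - z * (inner ℝ v x : ℝ))‖
      = Real.exp (-(z.re * inner ℝ v x)) := by
  rw [Complex.norm_exp]
  simp

/-- The Fourier-Laplace transform, damped by a Gaussian. -/
noncomputable def dampedExpFourier (f : Rn n → ℂ) (v : Rn n) (σ z : ℂ) (ξ : Rn n) : ℂ :=
  Complex.exp (-(σ * complexNormSq v ξ z)) * expFourier f v z ξ

theorem SuperExpDecay.continuous_dampedExpFourier (hf : SuperExpDecay f) (v : Rn n) (σ z : ℂ) :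
    Continuous (dampedExpFourier f v σ z) := by
  have h1 := hf.continuous_expFourier v z
  have h2 := continuous_complexNormSq v z
  unfold dampedExpFourier
  fun_prop

theorem SuperExpDecay.exists_norm_dampedExpFourier_le (hf : SuperExpDecay f) (v : Rn n)
    (ε τ R : ℝ) : ∃ C c : ℝ, ∀ z : ℂ, ‖z‖ ≤ R → ∀ ξ,
      ‖dampedExpFourier f v (ε + τ * Complex.I) z ξ‖ ≤
        C * Real.exp (c * ‖ξ‖ - ε * ‖ξ‖ ^ 2) := by
  obtain ⟨C, hC0, hC⟩ := hf.exists_norm_expFourier_le v R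
  refine ⟨C * Real.exp (‖ε + τ * Complex.I‖ * (R ^ 2 * (‖v‖ ^ 2 / (4 * Real.pi ^ 2)))),
    ‖ε + τ * Complex.I‖ * (R / Real.pi * ‖v‖), fun z hz ξ => ?_⟩
  rw [dampedExpFourier, norm_mul, mul_comm]
  refine (mul_le_mul (hC z ((Complex.abs_re_le_norm z).trans hz) ξ)
    (norm_exp_mul_complexNormSq_le v ξ ε τ hz) (norm_nonneg _) hC0).trans_eq ?_
  rw [← mul_assoc]

theorem SuperExpDecay.integrable_dampedExpFourier (hf : SuperExpDecay f) (v : Rn n) {ε : ℝ}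
    (hε : 0 < ε) (τ : ℝ) (z : ℂ) :
    Integrable (dampedExpFourier f v (ε + τ * Complex.I) z) := by
  obtain ⟨C, c, h⟩ := hf.exists_norm_dampedExpFourier_le v ε τ ‖z‖
  exact ((integrable_exp_linear_sub_sq c hε).const_mul C).mono'
    (hf.continuous_dampedExpFourier v _ z).aestronglyMeasurable (ae_of_all _ (h z le_rfl))

theorem SuperExpDecay.memLp_dampedExpFourier (hf : SuperExpDecay f) (v : Rn n) {ε : ℝ}
    (hε : 0 < ε) (τ : ℝ) (z : ℂ) :
    MemLp (dampedExpFourier f v (ε + τ * Complex.I) z) 2 := by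
  obtain ⟨C, c, h⟩ := hf.exists_norm_dampedExpFourier_le v ε τ ‖z‖
  have hm := (hf.continuous_dampedExpFourier v (ε + τ * Complex.I) z).aestronglyMeasurable
    (μ := volume)
  rw [memLp_two_iff_integrable_sq_norm hm]
  refine ((integrable_exp_linear_sub_sq (2 * c) (by positivity : 0 < 2 * ε)).const_mul
    (C ^ 2)).mono' (hm.norm.pow 2) (ae_of_all _ fun ξ => ?_)
  rw [Real.norm_of_nonneg (sq_nonneg _)]
  calc _ ≤ (C * Real.exp (c * ‖ξ‖ - ε * ‖ξ‖ ^ 2)) ^ 2 := by gcongr; exact h z le_rfl ξ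
    _ = _ := by rw [mul_pow, ← Real.exp_nat_mul]; push_cast; ring_nf

/-- Shifting the contour of the inverse Fourier transform by an imaginary vector. -/
theorem SuperExpDecay.exp_mul_fourierInv_dampedExpFourier (hf : SuperExpDecay f) (v x : Rn n)
    {ε : ℝ} (hε : 0 < ε) (τ p : ℝ) :
    (Real.exp (p * inner ℝ v x) : ℂ) * 𝓕⁻ (dampedExpFourier f v (ε + τ * Complex.I) 0) x
      = 𝓕⁻ (dampedExpFourier f v (ε + τ * Complex.I) p) x := by
  set σ : ℂ := ε + τ * Complex.I with hσ
  set Φ : ℂ → Rn n → ℂ := fun z ξ => Complex.exp (((2 * Real.pi * inner ℝ x ξ : ℝ) : ℂ) *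
    Complex.I - z * (inner ℝ v x : ℝ)) * dampedExpFourier f v σ z ξ with hΦ
  have hdiff : Differentiable ℂ (fun z => ∫ ξ, Φ z ξ) := by
    refine differentiable_integral_of_dominated (fun z => ?_) (fun ξ => ?_) (fun R => ?_)
    · have := hf.continuous_dampedExpFourier v σ z
      exact Continuous.aestronglyMeasurable (by fun_prop)
    · have h1 := hf.differentiable_expFourier v ξ
      have h2 := differentiable_complexNormSq v ξ
      simp only [hΦ, dampedExpFourier]
      fun_prop
    · obtain ⟨C, c, h⟩ := hf.exists_norm_dampedExpFourier_le v ε τ R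
      refine ⟨_, (((integrable_exp_linear_sub_sq c hε).const_mul C).const_mul
        (Real.exp (R * ‖(inner ℝ v x : ℝ)‖))), fun z hz ξ => ?_⟩
      rw [hΦ, norm_mul, norm_exp_inner_sub]
      refine mul_le_mul (Real.exp_le_exp.2 ?_) (h z hz ξ) (norm_nonneg _) (Real.exp_pos _).le
      refine (neg_le_abs _).trans ?_
      rw [abs_mul]
      exact mul_le_mul_of_nonneg_right ((Complex.abs_re_le_norm z).trans hz) (abs_nonneg _)
  -- For imaginary z the integrand is a real translate of the one at 0, so the integral does not
  -- change; the identity theorem extends this to all z.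
  have hconst : (fun z => ∫ ξ, Φ z ξ) = fun _ => ∫ ξ, Φ 0 ξ := by
    refine Differentiable.eq_of_eq_mul_I hdiff (differentiable_const _) fun y => ?_
    rw [← integral_sub_right_eq_self (Φ 0) ((y / (2 * Real.pi)) • v)]
    refine integral_congr_ae (ae_of_all _ fun ξ => ?_)
    have e := expFourier_add_mul_I f v 0 y ξ
    rw [zero_add] at e
    simp only [hΦ, dampedExpFourier]
    rw [e, complexNormSq_mul_I, complexNormSq_zero]
    congr 2
    rw [inner_sub_right, inner_smul_right, real_inner_comm v x]
    have : (Real.pi : ℂ) ≠ 0 := by exact_mod_cast Real.pi_ne_zero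
    push_cast
    field_simp
    ring
  have hinv : ∀ z : ℂ, ∫ ξ, Φ z ξ
      = Complex.exp (-(z * (inner ℝ v x : ℝ))) * 𝓕⁻ (dampedExpFourier f v σ z) x := by
    intro z
    rw [Real.fourierInv_eq', ← integral_const_mul]
    refine integral_congr_ae (ae_of_all _ fun ξ => ?_)
    simp only [hΦ, smul_eq_mul]
    rw [← mul_assoc, ← Complex.exp_add, real_inner_comm]
    congr 2
    ring
  have h := congrFun hconst p
  simp only [hinv] at h
  rw [zero_mul, neg_zero, Complex.exp_zero, one_mul] at h
  rw [← h, ← mul_assoc]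
  push_cast
  rw [← Complex.exp_add, add_neg_cancel, Complex.exp_zero, one_mul]

/-- After the contour shift Plancherel applies. The factor in front is the positive part left by the
damping and tends to 1 with ε. -/
theorem SuperExpDecay.expWeightNorm_fourierInv_le (hf : SuperExpDecay f) (v : Rn n)
    {ε : ℝ} (hε : 0 < ε) (τ p : ℝ) :
    expWeightNorm (fun x => p * inner ℝ v x)
        (𝓕⁻ (dampedExpFourier f v (ε + τ * Complex.I) 0)) ≤
      ENNReal.ofReal (Real.exp (ε * (p ^ 2 * (‖v‖ ^ 2 / (4 * Real.pi ^ 2))))) *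
      expWeightNorm (fun ξ => τ * p / Real.pi * inner ℝ v ξ) (expFourier f v p) := by
  rw [expWeightNorm, funext fun x => hf.exp_mul_fourierInv_dampedExpFourier v x hε τ p,
    eLpNorm_fourierInv_eq (hf.integrable_dampedExpFourier v hε τ p)
      (hf.memLp_dampedExpFourier v hε τ p), expWeightNorm]
  refine eLpNorm_le_mul_eLpNorm_of_ae_le_mul (ae_of_all _ fun ξ => ?_) 2
  rw [dampedExpFourier, norm_mul, norm_mul, Complex.norm_exp, re_mul_complexNormSq,
    Complex.norm_real, Real.norm_of_nonneg (Real.exp_pos _).le, ← mul_assoc, ← Real.exp_add]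
  gcongr
  have : 0 ≤ ε * ‖ξ‖ ^ 2 := by positivity
  linarith

open Filter Topology in
theorem tendsto_L2_of_tendsto_lintegral {V : ℕ → L2Rn n} {U : L2Rn n}
    (h : Tendsto (fun k => ∫⁻ ξ, ‖V k ξ - U ξ‖ₑ ^ 2) atTop (𝓝 0)) : Tendsto V atTop (𝓝 U) := by
  rw [Lp.tendsto_Lp_iff_tendsto_eLpNorm']
  have h1 : ∀ k, eLpNorm (⇑(V k) - ⇑U) 2 volume
      = (∫⁻ ξ, ‖V k ξ - U ξ‖ₑ ^ 2) ^ (1 / 2 : ℝ) := fun k => by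
    have h2 := eLpNorm_two_sq_eq_lintegral (μ := volume) (⇑(V k) - ⇑U)
    simp only [Pi.sub_apply] at h2
    rw [← h2, ← ENNReal.rpow_natCast, ← ENNReal.rpow_mul]
    norm_num
  simp only [h1]
  have h2 := (ENNReal.continuous_rpow_const (y := (1 / 2 : ℝ))).tendsto 0 |>.comp h
  simpa [Function.comp_def] using h2

open Filter Topology in
/-- Gaussian summability of the inverse Fourier transform on `L²`, along a subsequence. -/
theorem exists_tendsto_fourierInv_gaussian (U : L2Rn n) {W : ℕ → Rn n → ℂ}
    (hW : ∀ k : ℕ, ∀ᵐ ξ, W k ξ = Real.exp (-(1 / ((k : ℝ) + 1) * ‖ξ‖ ^ 2)) * U ξ)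
    (hWi : ∀ k, Integrable (W k)) (hW2 : ∀ k, MemLp (W k) 2) :
    ∃ ns : ℕ → ℕ, StrictMono ns ∧
      ∀ᵐ x, Tendsto (fun i => 𝓕⁻ (W (ns i)) x) atTop (𝓝 ((𝓕⁻ U : L2Rn n) x)) := by
  have hsub : ∀ k, ∀ᵐ ξ, ‖((hW2 k).toLp (W k) : Rn n → ℂ) ξ - U ξ‖ₑ ^ 2
      = ‖(Real.exp (-(1 / ((k : ℝ) + 1) * ‖ξ‖ ^ 2)) - 1 : ℝ)‖ₑ ^ 2 * ‖U ξ‖ₑ ^ 2 := fun k => by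
    filter_upwards [hW k, (hW2 k).coeFn_toLp] with ξ h1 h2
    rw [h2, h1, ← mul_pow]
    congr 1
    rw [← ofReal_norm (E := ℝ), ← Complex.norm_real, ofReal_norm, ← enorm_mul]
    congr 1
    push_cast; ring
  have hlim : Tendsto (fun k => (hW2 k).toLp (W k)) atTop (𝓝 U) := by
    refine tendsto_L2_of_tendsto_lintegral ?_
    have h0 : Tendsto (fun k => ∫⁻ ξ, ‖((hW2 k).toLp (W k) : Rn n → ℂ) ξ - U ξ‖ₑ ^ 2)
        atTop (𝓝 (∫⁻ _ : Rn n, 0)) := by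
      refine tendsto_lintegral_of_dominated_convergence' (fun ξ => ‖U ξ‖ₑ ^ 2)
        (fun k => by fun_prop) (fun k => ?_) ?_ ?_
      · filter_upwards [hsub k] with ξ hξ
        rw [hξ]
        refine mul_le_of_le_one_left' (pow_le_one' ?_ 2)
        rw [← ofReal_norm, Real.norm_eq_abs]
        refine ENNReal.ofReal_le_one.2 ?_
        have h1 : Real.exp (-(1 / ((k : ℝ) + 1) * ‖ξ‖ ^ 2)) ≤ 1 := by
          rw [Real.exp_le_one_iff, neg_nonpos]; positivity
        rw [abs_of_nonpos (by linarith)]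
        linarith [Real.exp_pos (-(1 / ((k : ℝ) + 1) * ‖ξ‖ ^ 2))]
      · rw [← eLpNorm_two_sq_eq_lintegral]
        exact ENNReal.pow_ne_top (Lp.eLpNorm_ne_top U)
      · filter_upwards [ae_all_iff.2 hsub] with ξ hξ
        simp only [hξ]
        have h1 : Tendsto (fun k : ℕ => (Real.exp (-(1 / ((k : ℝ) + 1) * ‖ξ‖ ^ 2)) - 1 : ℝ))
            atTop (𝓝 0) := by
          have h2 := (tendsto_one_div_add_atTop_nhds_zero_nat (𝕜 := ℝ)).mul_const (‖ξ‖ ^ 2)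
          have h3 := ((Real.continuous_exp.tendsto _).comp h2.neg).sub_const 1
          simpa using h3
        have h4 : Tendsto (fun k : ℕ =>
            ‖(Real.exp (-(1 / ((k : ℝ) + 1) * ‖ξ‖ ^ 2)) - 1 : ℝ)‖ₑ ^ 2) atTop (𝓝 0) := by
          simpa [Function.comp_def] using (ENNReal.continuous_pow 2).tendsto _ |>.comp h1.enorm
        simpa using ENNReal.Tendsto.mul_const (b := ‖U ξ‖ₑ ^ 2) h4
          (Or.inr (ENNReal.pow_ne_top enorm_ne_top))
    rw [lintegral_zero] at h0
    exact h0
  have hlim' : Tendsto (fun k => (𝓕⁻ ((hW2 k).toLp (W k)) : L2Rn n)) atTop (𝓝 (𝓕⁻ U)) :=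
    ((Lp.fourierTransformₗᵢ (Rn n) ℂ).symm.continuous.tendsto U).comp hlim
  obtain ⟨ns, hns, hae⟩ := (tendstoInMeasure_of_tendsto_Lp hlim').exists_seq_tendsto_ae
  refine ⟨ns, hns, ?_⟩
  have hcoe : ∀ k, (𝓕⁻ ((hW2 k).toLp (W k)) : L2Rn n) =ᵐ[volume] 𝓕⁻ (W k) := fun k => by
    have h1 := (hW2 k).coeFn_toLp
    have h2 := coeFn_fourierInv_L2 ((hW2 k).toLp (W k)) ((hWi k).congr h1.symm)
    have h3 : 𝓕⁻ ((hW2 k).toLp (W k) : Rn n → ℂ) = 𝓕⁻ (W k) := by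
      ext x
      simp only [Real.fourierInv_eq]
      exact integral_congr_ae (h1.mono fun ξ hξ => by simp only [hξ])
    rwa [h3] at h2
  filter_upwards [hae, ae_all_iff.2 hcoe] with x h1 h2
  simpa only [h2] using h1

open Filter Topology in
/-- Exponential decay of the free Schrödinger evolution `w` of `f`, in terms of the
Fourier-Laplace transform of `f`. -/
theorem SuperExpDecay.expWeightNorm_le_of_fourier_eq (hf : SuperExpDecay f) {τ : ℝ} (w : L2Rn n)
    (hw : ∀ᵐ ξ, (𝓕 w : L2Rn n) ξ = Complex.exp (-(τ * Complex.I * (‖ξ‖ ^ 2 : ℝ))) * 𝓕 f ξ)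
    (v : Rn n) (p : ℝ) :
    expWeightNorm (fun x => p * inner ℝ v x) w ≤
      expWeightNorm (fun ξ => τ * p / Real.pi * inner ℝ v ξ) (expFourier f v p) := by
  set ε : ℕ → ℝ := fun k => 1 / ((k : ℝ) + 1) with hε
  have hε0 : ∀ k, 0 < ε k := fun k => by positivity
  set W : ℕ → Rn n → ℂ := fun k => dampedExpFourier f v (ε k + τ * Complex.I) 0 with hW
  obtain ⟨ns, hns, hlim⟩ := exists_tendsto_fourierInv_gaussian (𝓕 w) (W := W)
    (fun k => by
      filter_upwards [hw] with ξ hξ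
      simp only [hW]
      rw [dampedExpFourier, complexNormSq_zero, expFourier_zero, hξ, ← mul_assoc,
        Complex.ofReal_exp, ← Complex.exp_add]
      congr 2
      simp only [hε]
      push_cast; ring)
    (fun k => hf.integrable_dampedExpFourier v (hε0 k) τ 0)
    (fun k => hf.memLp_dampedExpFourier v (hε0 k) τ 0)
  rw [FourierTransform.fourierInv_fourier_eq] at hlim
  set Λ := expWeightNorm (fun ξ => τ * p / Real.pi * inner ℝ v ξ) (expFourier f v p)
  set b : ℕ → ℝ≥0∞ := fun k =>
    ENNReal.ofReal (Real.exp (ε k * (p ^ 2 * (‖v‖ ^ 2 / (4 * Real.pi ^ 2))))) with hb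
  -- Fatou along the subsequence: from index K on, the damping parameter is at most `ε K`, so one
  -- constant serves the whole tail; K then tends to infinity.
  have hbound : ∀ K : ℕ, expWeightNorm (fun x => p * inner ℝ v x) w ≤ b K * Λ := by
    intro K
    refine Lp.eLpNorm_le_of_ae_tendsto (u := atTop)
      (f := fun i x => (Real.exp (p * inner ℝ v x) : ℂ) * 𝓕⁻ (W (ns i)) x) ?_ (fun i => ?_) ?_
    · filter_upwards [eventually_ge_atTop K] with i hi
      refine (hf.expWeightNorm_fourierInv_le v (hε0 (ns i)) τ p).trans ?_
      have : ε (ns i) ≤ ε K := by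
        simp only [hε]
        have : (K : ℝ) ≤ ns i := by exact_mod_cast hi.trans (hns.id_le i)
        gcongr
      simp only [hb]
      gcongr
    · rw [funext fun x => hf.exp_mul_fourierInv_dampedExpFourier v x (hε0 (ns i)) τ p]
      exact (show Continuous (𝓕⁻ (dampedExpFourier f v (ε (ns i) + τ * Complex.I) p)) from
        continuous_fourierInv_of_integrable
          (hf.integrable_dampedExpFourier v (hε0 (ns i)) τ p)).aestronglyMeasurable
    · filter_upwards [hlim] with x hx
      exact hx.const_mul _
  have hb1 : Tendsto b atTop (𝓝 1) := by
    have h2 := (tendsto_one_div_add_atTop_nhds_zero_nat (𝕜 := ℝ)).mul_const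
      (p ^ 2 * (‖v‖ ^ 2 / (4 * Real.pi ^ 2)))
    rw [zero_mul] at h2
    have h3 := (ENNReal.continuous_ofReal.comp Real.continuous_exp).tendsto 0 |>.comp h2
    simpa [Function.comp_def, hb, hε] using h3
  have hfinal : Tendsto (fun k => b k * Λ) atTop (𝓝 (1 * Λ)) :=
    ENNReal.Tendsto.mul_const hb1 (Or.inl one_ne_zero)
  rw [one_mul] at hfinal
  exact ge_of_tendsto' hfinal hbound

end GaussianMultiplier

/-! ### Gaussian weights as averages of linear weights. -/

section Superposition

variable {n : ℕ}

theorem expWeightNorm_sq (w : Rn n → ℝ) (f : Rn n → ℂ) :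
    expWeightNorm w f ^ 2 = ∫⁻ x, ENNReal.ofReal (Real.exp (2 * w x)) * ‖f x‖ₑ ^ 2 := by
  rw [expWeightNorm, eLpNorm_two_sq_eq_lintegral]
  refine lintegral_congr fun x => ?_
  rw [enorm_mul, mul_pow, ← ofReal_norm (Real.exp (w x) : ℂ), Complex.norm_real,
    Real.norm_of_nonneg (Real.exp_pos _).le, ← ENNReal.ofReal_pow (Real.exp_pos _).le,
    ← Real.exp_nat_mul]
  norm_num

theorem expWeightNorm_congr_ae (w : Rn n → ℝ) {f g : Rn n → ℂ} (h : f =ᵐ[volume] g) :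
    expWeightNorm w f = expWeightNorm w g :=
  eLpNorm_congr_ae (h.mono fun x hx => by simp only [hx])

theorem expWeightNorm_inner_add (c : ℝ) (v a : Rn n) (f : Rn n → ℂ) :
    expWeightNorm (fun x => c * inner ℝ v (x + a)) f =
      ENNReal.ofReal (Real.exp (c * inner ℝ v a)) * expWeightNorm (fun x => c * inner ℝ v x) f := by
  have h : (fun x => (Real.exp (c * inner ℝ v (x + a)) : ℂ) * f x)
      = (Real.exp (c * inner ℝ v a) : ℂ) • fun x => (Real.exp (c * inner ℝ v x) : ℂ) * f x := by
    ext x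
    rw [Pi.smul_apply, smul_eq_mul, ← mul_assoc, ← Complex.ofReal_mul, ← Real.exp_add,
      inner_add_right]
    ring_nf
  rw [expWeightNorm, h, eLpNorm_const_smul, expWeightNorm, ← ofReal_norm, Complex.norm_real,
    Real.norm_of_nonneg (Real.exp_pos _).le]

/-- The mass of the Gaussian `e^{-|v|²/2}`. -/
noncomputable def gaussianMass (n : ℕ) : ℝ≥0∞ :=
  ∫⁻ v : Rn n, ENNReal.ofReal (Real.exp (-(‖v‖ ^ 2 / 2)))

theorem gaussianMass_ne_zero : gaussianMass n ≠ 0 := by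
  rw [gaussianMass, ne_eq, lintegral_eq_zero_iff (by fun_prop)]
  intro h
  have h1 : ∀ᵐ v : Rn n, False := h.mono fun v hv => by
    simp only [Pi.zero_apply, ENNReal.ofReal_eq_zero] at hv
    exact absurd hv (not_le.2 (Real.exp_pos _))
  exact h1.exists.elim fun _ => id

theorem gaussianMass_ne_top : gaussianMass n ≠ ∞ := by
  have h := (integrable_exp_linear_sub_sq (n := n) 0 (δ := 1 / 2) (by norm_num)).lintegral_lt_top
  refine (lt_of_le_of_lt (lintegral_mono fun v => ?_) h).ne
  refine ENNReal.ofReal_le_ofReal (Real.exp_le_exp.2 ?_)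
  linarith

/-- Translate v by 2y and complete the square: -|v - 2y|²/2 = -|v|²/2 + 2v·y - 2|y|². -/
theorem lintegral_gaussian_mul_exp_inner (y : Rn n) :
    ∫⁻ v : Rn n, ENNReal.ofReal (Real.exp (-(‖v‖ ^ 2 / 2))) *
        ENNReal.ofReal (Real.exp (2 * inner ℝ v y))
      = ENNReal.ofReal (Real.exp (2 * ‖y‖ ^ 2)) * gaussianMass n := by
  rw [gaussianMass, ← lintegral_sub_right_eq_self
    (fun v : Rn n => ENNReal.ofReal (Real.exp (-(‖v‖ ^ 2 / 2)))) ((2 : ℝ) • y),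
    ← lintegral_const_mul _ (by fun_prop)]
  refine lintegral_congr fun v => ?_
  rw [← ENNReal.ofReal_mul (Real.exp_pos _).le, ← ENNReal.ofReal_mul (Real.exp_pos _).le,
    ← Real.exp_add, ← Real.exp_add, norm_sub_sq_real, inner_smul_right, norm_smul]
  congr 2
  rw [Real.norm_of_nonneg (by norm_num)]
  ring

theorem aemeasurable_exp_inner_mul {f : Rn n → ℂ} (hf : AEStronglyMeasurable f) (a : Rn n)
    (c : ℝ) : AEMeasurable (fun z : Rn n × Rn n => ENNReal.ofReal (Real.exp (-(‖z.1‖ ^ 2 / 2))) *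
      (ENNReal.ofReal (Real.exp (2 * (c * inner ℝ z.1 (z.2 + a)))) * ‖f z.2‖ₑ ^ 2))
      (volume.prod volume) := by
  have h1 : AEStronglyMeasurable (fun z : Rn n × Rn n => f z.2) (volume.prod volume) := hf.comp_snd
  fun_prop

/-- A Gaussian weight is a superposition of linear exponential weights. -/
theorem gaussianMass_mul_expWeightNorm_sq {f : Rn n → ℂ} (hf : AEStronglyMeasurable f) (a : Rn n)
    (r : ℝ) :
    gaussianMass n * expWeightNorm (fun x => ‖x + a‖ ^ 2 / r ^ 2) f ^ 2 =
      ∫⁻ v : Rn n, ENNReal.ofReal (Real.exp (-(‖v‖ ^ 2 / 2))) *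
        expWeightNorm (fun x => r⁻¹ * inner ℝ v (x + a)) f ^ 2 := by
  have hm := aemeasurable_exp_inner_mul hf a r⁻¹
  have h1 : ∀ v : Rn n, ENNReal.ofReal (Real.exp (-(‖v‖ ^ 2 / 2))) *
      expWeightNorm (fun x => r⁻¹ * inner ℝ v (x + a)) f ^ 2
      = ∫⁻ x, ENNReal.ofReal (Real.exp (-(‖v‖ ^ 2 / 2))) *
        (ENNReal.ofReal (Real.exp (2 * (r⁻¹ * inner ℝ v (x + a)))) * ‖f x‖ₑ ^ 2) := fun v => by
    rw [expWeightNorm_sq, lintegral_const_mul' _ _ ENNReal.ofReal_ne_top]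
  simp only [h1]
  rw [lintegral_lintegral_swap hm, expWeightNorm_sq, mul_comm,
    ← lintegral_mul_const' _ _ gaussianMass_ne_top]
  refine lintegral_congr fun x => ?_
  have h2 := lintegral_gaussian_mul_exp_inner (r⁻¹ • (x + a))
  simp only [inner_smul_right, norm_smul, mul_pow] at h2
  rw [show 2 * (‖x + a‖ ^ 2 / r ^ 2) = 2 * (‖r⁻¹‖ ^ 2 * ‖x + a‖ ^ 2) by
    rw [Real.norm_eq_abs, sq_abs, inv_pow]; ring, mul_right_comm, ← h2,
    ← lintegral_mul_const' _ _ (ENNReal.pow_ne_top enorm_ne_top)]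
  refine lintegral_congr fun v => ?_
  rw [mul_assoc]

theorem aemeasurable_gaussian_mul_expWeightNorm_sq {f : Rn n → ℂ} (hf : AEStronglyMeasurable f)
    (a : Rn n) (r : ℝ) :
    AEMeasurable (fun v : Rn n => ENNReal.ofReal (Real.exp (-(‖v‖ ^ 2 / 2))) *
        expWeightNorm (fun x => r⁻¹ * inner ℝ v (x + a)) f ^ 2) := by
  have h := (aemeasurable_exp_inner_mul hf a r⁻¹).lintegral_prod_right'
  refine h.congr (ae_of_all _ fun v => ?_)
  simp only
  rw [expWeightNorm_sq, lintegral_const_mul' _ _ ENNReal.ofReal_ne_top]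

/-- Interpolation inequalities for linear exponential weights imply the corresponding inequality
for Gaussian weights. -/
theorem expWeightNorm_gaussian_interp_le {f g h : Rn n → ℂ} (hf : AEStronglyMeasurable f)
    (hg : AEStronglyMeasurable g) (hh : AEStronglyMeasurable h) {a b c : Rn n} {r s t : ℝ} {θ : ℝ}
    (hθ : θ ∈ Icc (0 : ℝ) 1) (habc : r⁻¹ • a = θ • s⁻¹ • b + (1 - θ) • t⁻¹ • c)
    (H : ∀ v, expWeightNorm (fun x => r⁻¹ * inner ℝ v x) f ≤
      expWeightNorm (fun x => s⁻¹ * inner ℝ v x) g ^ θ *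
      expWeightNorm (fun x => t⁻¹ * inner ℝ v x) h ^ (1 - θ)) :
    expWeightNorm (fun x => ‖x + a‖ ^ 2 / r ^ 2) f ≤
      expWeightNorm (fun x => ‖x + b‖ ^ 2 / s ^ 2) g ^ θ *
      expWeightNorm (fun x => ‖x + c‖ ^ 2 / t ^ 2) h ^ (1 - θ) := by
  have hθ0 := hθ.1
  have hθ1 : 0 ≤ 1 - θ := sub_nonneg.2 hθ.2
  have hmul : ∀ x y : ℝ≥0∞, ∀ κ : ℝ, 0 ≤ κ → (x * y) ^ κ = x ^ κ * y ^ κ := fun x y κ hκ =>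
    ENNReal.mul_rpow_of_nonneg x y hκ
  have hself : ∀ x : ℝ≥0∞, x ^ θ * x ^ (1 - θ) = x := fun x => by
    rw [← ENNReal.rpow_add_of_nonneg _ _ hθ0 hθ1, add_sub_cancel, ENNReal.rpow_one]
  have hsq : ∀ x : ℝ≥0∞, ∀ κ : ℝ, (x ^ 2) ^ κ = (x ^ κ) ^ 2 := fun x κ => by
    rw [← ENNReal.rpow_natCast, ← ENNReal.rpow_natCast, ← ENNReal.rpow_mul, ← ENNReal.rpow_mul,
      mul_comm]
  have Hshift : ∀ v, expWeightNorm (fun x => r⁻¹ * inner ℝ v (x + a)) f ≤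
      expWeightNorm (fun x => s⁻¹ * inner ℝ v (x + b)) g ^ θ *
      expWeightNorm (fun x => t⁻¹ * inner ℝ v (x + c)) h ^ (1 - θ) := by
    intro v
    rw [expWeightNorm_inner_add, expWeightNorm_inner_add, expWeightNorm_inner_add, hmul _ _ _ hθ0,
      hmul _ _ _ hθ1, mul_mul_mul_comm]
    refine mul_le_mul' (le_of_eq ?_) (H v)
    rw [ENNReal.ofReal_rpow_of_pos (Real.exp_pos _), ENNReal.ofReal_rpow_of_pos (Real.exp_pos _),
      ← ENNReal.ofReal_mul (by positivity), ← Real.exp_mul, ← Real.exp_mul, ← Real.exp_add]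
    -- The relation `habc` between the centres says precisely that the constant exponentials on the
    -- two sides agree.
    congr 2
    have h1 := congrArg (inner ℝ v) habc
    simp only [inner_add_right, inner_smul_right] at h1
    rw [h1]; ring
  have key : gaussianMass n * expWeightNorm (fun x => ‖x + a‖ ^ 2 / r ^ 2) f ^ 2 ≤
      gaussianMass n * (expWeightNorm (fun x => ‖x + b‖ ^ 2 / s ^ 2) g ^ θ *
      expWeightNorm (fun x => ‖x + c‖ ^ 2 / t ^ 2) h ^ (1 - θ)) ^ 2 := by
    -- The Gaussian density is split into its powers θ and 1 - θ, so that Hölder's inequality in v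
    -- returns the two Gaussian weights.
    calc _ ≤ ∫⁻ v : Rn n, (ENNReal.ofReal (Real.exp (-(‖v‖ ^ 2 / 2))) *
              expWeightNorm (fun x => s⁻¹ * inner ℝ v (x + b)) g ^ 2) ^ θ *
            (ENNReal.ofReal (Real.exp (-(‖v‖ ^ 2 / 2))) *
              expWeightNorm (fun x => t⁻¹ * inner ℝ v (x + c)) h ^ 2) ^ (1 - θ) := by
          rw [gaussianMass_mul_expWeightNorm_sq hf]
          refine lintegral_mono fun v => ?_
          simp only
          rw [hmul _ _ _ hθ0, hmul _ _ _ hθ1, mul_mul_mul_comm, hself, hsq, hsq, ← mul_pow]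
          gcongr
          exact Hshift v
      _ ≤ _ := ENNReal.lintegral_mul_norm_pow_le
          (aemeasurable_gaussian_mul_expWeightNorm_sq hg b s)
          (aemeasurable_gaussian_mul_expWeightNorm_sq hh c t) hθ0 hθ1 (add_sub_cancel _ _)
      _ = _ := by
          rw [← gaussianMass_mul_expWeightNorm_sq hg, ← gaussianMass_mul_expWeightNorm_sq hh,
            hmul _ _ _ hθ0, hmul _ _ _ hθ1, mul_mul_mul_comm, hself, hsq, hsq, ← mul_pow]
  rw [ENNReal.mul_le_mul_iff_right gaussianMass_ne_zero gaussianMass_ne_top] at key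
  exact (ENNReal.pow_le_pow_left_iff two_ne_zero).1 key

/-- Needed where 0 · ∞ = 0 could make a right-hand side vanish: the unweighted norm is conserved, so
the left-hand side then vanishes too. -/
theorem expWeightNorm_eq_zero_iff {w : Rn n → ℝ} (hw : Continuous w) {f : Rn n → ℂ}
    (hf : AEStronglyMeasurable f) : expWeightNorm w f = 0 ↔ eLpNorm f 2 = 0 := by
  have hm : AEStronglyMeasurable (fun x => (Real.exp (w x) : ℂ) * f x) :=
    (Continuous.aestronglyMeasurable (by fun_prop)).mul hf
  rw [expWeightNorm, eLpNorm_eq_zero_iff hm two_ne_zero, eLpNorm_eq_zero_iff hf two_ne_zero]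
  refine Filter.eventually_congr (ae_of_all _ fun x => ?_)
  simp

theorem SuperExpDecay.expWeightNorm_inner_ne_top {f : Rn n → ℂ} (hf : SuperExpDecay f) (c : ℝ)
    (v : Rn n) : expWeightNorm (fun x => c * inner ℝ v x) f ≠ ∞ := by
  have h := (hf.memLp_cexp_mul v c).2.ne
  have h2 : (fun x => Complex.exp ((c : ℂ) * (inner ℝ v x : ℝ)) * f x)
      = fun x => (Real.exp (c * inner ℝ v x) : ℂ) * f x := by
    ext x; push_cast; rfl
  rwa [h2] at h

end Superposition

/-! ### The unitary normalization of the Fourier transform. -/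

section UnitaryFourier

variable {n : ℕ}

theorem lintegral_comp_smul_two_pi_inv (F : Rn n → ℝ≥0∞) :
    ∫⁻ ξ, F ((2 * Real.pi)⁻¹ • ξ) = ENNReal.ofReal ((2 * Real.pi) ^ n) * ∫⁻ ξ, F ξ := by
  have hc : (2 * Real.pi)⁻¹ ≠ 0 := by positivity
  have h := lintegral_map_equiv (μ := (volume : Measure (Rn n))) F
    (Homeomorph.smulOfNeZero (2 * Real.pi)⁻¹ hc).toMeasurableEquiv
  have h2 : Measure.map (Homeomorph.smulOfNeZero (α := Rn n) (2 * Real.pi)⁻¹ hc).toMeasurableEquiv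
      volume = ENNReal.ofReal ((2 * Real.pi) ^ n) • (volume : Measure (Rn n)) := by
    have h3 := Measure.map_addHaar_smul (volume : Measure (Rn n)) hc
    rw [finrank_euclideanSpace_fin, inv_pow, inv_inv, abs_of_nonneg (by positivity)] at h3
    exact h3
  rw [h2, lintegral_smul_measure, smul_eq_mul] at h
  exact h.symm

theorem expWeightNorm_unitary_dilation (w : Rn n → ℝ) (F : Rn n → ℂ) :
    expWeightNorm w (fun ξ => (((2 * Real.pi) ^ (-(n : ℝ) / 2) : ℝ) : ℂ) *
      F ((2 * Real.pi)⁻¹ • ξ)) = expWeightNorm (fun ξ => w ((2 * Real.pi) • ξ)) F := by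
  refine (ENNReal.pow_right_strictMono two_ne_zero).injective ?_
  rw [expWeightNorm_sq, expWeightNorm_sq]
  have h0 : (0 : ℝ) ≤ 2 * Real.pi := by positivity
  have h := lintegral_comp_smul_two_pi_inv
    (fun ξ : Rn n => ENNReal.ofReal (Real.exp (2 * w ((2 * Real.pi) • ξ))) * ‖F ξ‖ₑ ^ 2)
  simp only [smul_inv_smul₀ (by positivity : 2 * Real.pi ≠ 0)] at h
  have h1 : ∀ ξ, ‖(((2 * Real.pi) ^ (-(n : ℝ) / 2) : ℝ) : ℂ) * F ((2 * Real.pi)⁻¹ • ξ)‖ₑ ^ 2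
      = ENNReal.ofReal ((2 * Real.pi) ^ n)⁻¹ * ‖F ((2 * Real.pi)⁻¹ • ξ)‖ₑ ^ 2 := fun ξ => by
    rw [enorm_mul, mul_pow, ← ofReal_norm, Complex.norm_real, Real.norm_of_nonneg (by positivity),
      ← ENNReal.ofReal_pow (by positivity), ← Real.rpow_natCast, ← Real.rpow_mul h0,
      ← Real.rpow_natCast, ← Real.rpow_neg h0]
    congr 3
    push_cast; ring
  simp only [h1, mul_left_comm]
  rw [lintegral_const_mul' _ _ ENNReal.ofReal_ne_top, h, ← mul_assoc,
    ← ENNReal.ofReal_mul (by positivity), inv_mul_cancel₀ (by positivity), ENNReal.ofReal_one,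
    one_mul]

theorem expWeightNorm_fourierHat (w : Rn n → ℝ) (f : L2Rn n) :
    expWeightNorm w (fourierHat f)
      = expWeightNorm (fun ξ => w ((2 * Real.pi) • ξ)) (𝓕 f : L2Rn n) :=
  expWeightNorm_unitary_dilation w _

theorem aestronglyMeasurable_fourierHat (f : L2Rn n) : AEStronglyMeasurable (fourierHat f) := by
  refine AEStronglyMeasurable.const_mul ?_ _
  refine (Lp.aestronglyMeasurable (𝓕 f : L2Rn n)).comp_quasiMeasurePreserving
    ⟨by fun_prop, ?_⟩
  rw [Measure.map_addHaar_smul volume (by positivity : (2 * Real.pi)⁻¹ ≠ 0)]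
  exact Measure.smul_absolutelyContinuous

theorem eLpNorm_fourier_L2 (f : L2Rn n) :
    eLpNorm (𝓕 f : L2Rn n) 2 volume = eLpNorm f 2 volume := by
  rw [← Lp.enorm_def, ← Lp.enorm_def, ← ofReal_norm, ← ofReal_norm, Lp.norm_fourier_eq]

theorem eLpNorm_fourierHat (f : L2Rn n) : eLpNorm (fourierHat f) 2 = eLpNorm f 2 := by
  have h := expWeightNorm_fourierHat (fun _ => 0) f
  simpa [expWeightNorm, eLpNorm_fourier_L2] using h

end UnitaryFourier

/-! ### Linear weights along the free flow. -/

section Schrodinger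

variable {n : ℕ} {u₀ : L2Rn n} {u : ℝ → L2Rn n}

theorem SuperExpDecay.coeFn_fourier {f : L2Rn n} (hf : SuperExpDecay (f : Rn n → ℂ)) :
    (𝓕 f : L2Rn n) =ᵐ[volume] 𝓕 (f : Rn n → ℂ) :=
  coeFn_fourier_L2 f (by simpa using hf.integrable 0)

theorem IsFreeSchrodingerSolution.fourier_eq_exp_mul (hu : IsFreeSchrodingerSolution u₀ u) {t : ℝ}
    (ht : 0 ≤ t) : ∀ᵐ ξ, (𝓕 (u t) : L2Rn n) ξ =
      Complex.exp (-((((2 * Real.pi) ^ 2 * t : ℝ) : ℂ) * Complex.I * (‖ξ‖ ^ 2 : ℝ))) *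
        (𝓕 (u 0) : L2Rn n) ξ := by
  filter_upwards [hu.fourier_eq ht] with ξ hξ
  rw [← hξ, schrodingerPhase, ← mul_assoc, ← Complex.exp_add]
  have e : -((((2 * Real.pi) ^ 2 * t : ℝ) : ℂ) * Complex.I * (‖ξ‖ ^ 2 : ℝ))
      + ((2 * Real.pi) ^ 2 * ‖ξ‖ ^ 2 * t : ℝ) * Complex.I = 0 := by push_cast; ring
  rw [e, Complex.exp_zero, one_mul]

theorem IsFreeSchrodingerSolution.eLpNorm_eq (hu : IsFreeSchrodingerSolution u₀ u) {t : ℝ}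
    (ht : 0 ≤ t) : eLpNorm (u t) 2 volume = eLpNorm (u 0) 2 volume := by
  rw [← eLpNorm_fourier_L2, ← eLpNorm_fourier_L2 (u 0)]
  refine eLpNorm_congr_norm_ae ?_
  filter_upwards [hu.fourier_eq ht] with ξ hξ
  rw [← hξ, norm_mul, norm_schrodingerPhase, one_mul]

theorem two_pi_sq_mul_div_pi (t p : ℝ) :
    (2 * Real.pi) ^ 2 * t * p / Real.pi = 4 * Real.pi * t * p := by
  have := Real.pi_ne_zero
  field_simp
  ring

theorem IsFreeSchrodingerSolution.expWeightNorm_inner_le (hu : IsFreeSchrodingerSolution u₀ u)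
    (h0 : SuperExpDecay (u 0 : Rn n → ℂ)) {t : ℝ} (ht : 0 ≤ t) (v : Rn n) (p : ℝ) :
    expWeightNorm (fun x => p * inner ℝ v x) (u t) ≤
      expWeightNorm (fun ξ => 4 * Real.pi * t * p * inner ℝ v ξ) (expFourier (u 0) v p) := by
  rw [← two_pi_sq_mul_div_pi]
  refine h0.expWeightNorm_le_of_fourier_eq (u t) ?_ v p
  filter_upwards [hu.fourier_eq_exp_mul ht, h0.coeFn_fourier] with ξ h1 h2
  rw [h1, h2]

theorem IsFreeSchrodingerSolution.expWeightNorm_inner_eq (hu : IsFreeSchrodingerSolution u₀ u)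
    (h0 : SuperExpDecay (u 0 : Rn n → ℂ)) {T : ℝ} (hT : 0 ≤ T)
    (hdT : SuperExpDecay (u T : Rn n → ℂ)) (v : Rn n) (p : ℝ) :
    expWeightNorm (fun ξ => 4 * Real.pi * T * p * inner ℝ v ξ) (expFourier (u 0) v p) =
      expWeightNorm (fun x => p * inner ℝ v x) (u T) := by
  rw [← two_pi_sq_mul_div_pi]
  refine h0.expWeightNorm_expFourier_eq hdT ?_ v p
  filter_upwards [hu.fourier_eq_exp_mul hT, h0.coeFn_fourier, hdT.coeFn_fourier] with ξ h1 h2 h3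
  rw [← h3, h1, h2]

theorem SuperExpDecay.expWeightNorm_expFourier_zero {f : Rn n → ℂ} (hf : SuperExpDecay f)
    (v : Rn n) (p : ℝ) : expWeightNorm (fun ξ => 0 * inner ℝ v ξ) (expFourier f v p)
      = expWeightNorm (fun x => p * inner ℝ v x) f := by
  have h := hf.eLpNorm_expFourier v p
  simpa [expWeightNorm] using h

/-- Log-convexity for linear exponential weights, between two times. -/
theorem IsFreeSchrodingerSolution.expWeightNorm_inner_interp_le
    (hu : IsFreeSchrodingerSolution u₀ u) (h0 : SuperExpDecay (u 0 : Rn n → ℂ)) {t T : ℝ}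
    (ht : 0 ≤ t) (hT : 0 ≤ T) (hdT : SuperExpDecay (u T : Rn n → ℂ)) {p p₀ p₁ θ : ℝ}
    (hθ : θ ∈ Icc (0 : ℝ) 1) (hp : p = θ * p₁ + (1 - θ) * p₀)
    (htp : t * p = (1 - θ) * (T * p₀)) (v : Rn n) :
    expWeightNorm (fun x => p * inner ℝ v x) (u t) ≤
      expWeightNorm (fun x => p₁ * inner ℝ v x) (u 0) ^ θ *
      expWeightNorm (fun x => p₀ * inner ℝ v x) (u T) ^ (1 - θ) := by
  have e0 := hu.expWeightNorm_inner_eq h0 hT hdT v p₀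
  have e1 := h0.expWeightNorm_expFourier_zero v p₁
  -- The segment runs from (p₀, 4πTp₀), time T, to (p₁, 0), time 0; `hp` and `htp` place (p, 4πtp)
  -- on it at parameter θ.
  have h := h0.expWeightNorm_expFourier_interp_le v p₀ (4 * Real.pi * T * p₀) (p₁ - p₀)
    (-(4 * Real.pi * T * p₀)) hθ (by rw [e0]; exact hdT.expWeightNorm_inner_ne_top _ v)
    (by rw [add_neg_cancel, add_sub_cancel, e1]; exact h0.expWeightNorm_inner_ne_top _ v)
  rw [add_neg_cancel, add_sub_cancel, e0, e1] at h
  rw [show 4 * Real.pi * T * p₀ + θ * -(4 * Real.pi * T * p₀) = 4 * Real.pi * t * p by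
      linear_combination (-4 * Real.pi) * htp,
    show p₀ + θ * (p₁ - p₀) = p by rw [hp]; ring] at h
  exact (hu.expWeightNorm_inner_le h0 ht v p).trans (h.trans_eq (mul_comm _ _))

/-- Log-convexity for linear exponential weights, between a time and a frequency bound. -/
theorem IsFreeSchrodingerSolution.expWeightNorm_inner_interp_fourier_le
    (hu : IsFreeSchrodingerSolution u₀ u) (h0 : SuperExpDecay (u 0 : Rn n → ℂ)) {t : ℝ}
    (ht : 0 ≤ t) (hd : SuperExpDecay (fourierHat (u 0))) {p q p₁ θ : ℝ}
    (hθ : θ ∈ Icc (0 : ℝ) 1) (hp : p = θ * p₁) (htp : 2 * t * p = (1 - θ) * q) (v : Rn n) :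
    expWeightNorm (fun x => p * inner ℝ v x) (u t) ≤
      expWeightNorm (fun x => p₁ * inner ℝ v x) (u 0) ^ θ *
      expWeightNorm (fun x => q * inner ℝ v x) (fourierHat (u 0)) ^ (1 - θ) := by
  have e0 : expWeightNorm (fun ξ => 2 * Real.pi * q * inner ℝ v ξ)
      (expFourier (u 0) v ((0 : ℝ) : ℂ))
      = expWeightNorm (fun x => q * inner ℝ v x) (fourierHat (u 0)) := by
    rw [expWeightNorm_fourierHat, Complex.ofReal_zero, expFourier_zero,
      expWeightNorm_congr_ae _ h0.coeFn_fourier]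
    congr 1
    ext ξ
    rw [inner_smul_right]; ring
  have e1 := h0.expWeightNorm_expFourier_zero v p₁
  -- The time-T endpoint is replaced by (0, 2πq), with no spatial weight; the factor 2π comes from
  -- the dilation in `fourierHat`.
  have h := h0.expWeightNorm_expFourier_interp_le v 0 (2 * Real.pi * q) p₁
    (-(2 * Real.pi * q)) hθ (by rw [e0]; exact hd.expWeightNorm_inner_ne_top _ v)
    (by rw [add_neg_cancel, zero_add, e1]; exact h0.expWeightNorm_inner_ne_top _ v)
  rw [add_neg_cancel, zero_add, zero_add, e0, e1] at h
  rw [show 2 * Real.pi * q + θ * -(2 * Real.pi * q) = 4 * Real.pi * t * p by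
      linear_combination (-2 * Real.pi) * htp, ← hp] at h
  exact (hu.expWeightNorm_inner_le h0 ht v p).trans (h.trans_eq (mul_comm _ _))

end Schrodinger

/-! ### Degenerate cases and conclusion. -/

/-- An interpolation inequality in `[0, ∞]` follows from its nondegenerate cases. -/
theorem ENNReal.le_rpow_mul_rpow_of_finite {a b c : ℝ≥0∞} {θ : ℝ} (hθ : θ ∈ Icc (0 : ℝ) 1)
    (h : b ≠ ∞ → c ≠ ∞ → a ≤ b ^ θ * c ^ (1 - θ)) (h0 : θ = 0 → a ≤ c) (h1 : θ = 1 → a ≤ b)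
    (hb : b = 0 → a = 0) (hc : c = 0 → a = 0) : a ≤ b ^ θ * c ^ (1 - θ) := by
  rcases hθ.1.eq_or_lt with rfl | hpos
  · simpa using h0 rfl
  rcases hθ.2.eq_or_lt with rfl | hlt
  · simpa using h1 rfl
  have hlt' : 0 < 1 - θ := sub_pos.2 hlt
  -- Zero factors are removed first; afterwards an infinite factor with a positive exponent really
  -- makes the product infinite.
  by_cases hb0 : b = 0
  · simp [hb hb0]
  by_cases hc0 : c = 0
  · simp [hc hc0]
  by_cases hbt : b = ∞
  · rw [hbt, ENNReal.top_rpow_of_pos hpos, ENNReal.top_mul]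
    · exact le_top
    · simp [ENNReal.rpow_eq_zero_iff, hc0, not_lt.2 hlt'.le]
  by_cases hct : c = ∞
  · rw [hct, ENNReal.top_rpow_of_pos hlt', ENNReal.mul_top]
    · exact le_top
    · simp [ENNReal.rpow_eq_zero_iff, hb0, not_lt.2 hpos.le]
  exact h hbt hct

theorem corollary3p5 (n : ℕ) (α β : ℝ) (hα : 0 < α) (hβ : 0 < β)
    (u₀ : L2Rn n) (u : ℝ → L2Rn n) (hu : IsFreeSchrodingerSolution u₀ u) (ν : Rn n) :
    (∀ T : ℝ, 0 < T → ∀ t : ℝ, 0 ≤ t → t ≤ T →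
      expWeightNorm (fun x => ‖x + (2 * t) • ν‖ ^ 2 / (α * t + β) ^ 2) (u t) ≤
        expWeightNorm (fun x => ‖x‖ ^ 2 / β ^ 2) (u 0) ^
            (β * (T - t) / (T * (α * t + β))) *
          expWeightNorm (fun x => ‖x + (2 * T) • ν‖ ^ 2 / (α * T + β) ^ 2) (u T) ^
            (1 - β * (T - t) / (T * (α * t + β)))) ∧
    (∀ t : ℝ, 0 ≤ t →
      expWeightNorm (fun x => ‖x + (2 * t) • ν‖ ^ 2 / (α * t + β) ^ 2) (u t) ≤
        expWeightNorm (fun x => ‖x‖ ^ 2 / β ^ 2) (u 0) ^ (β / (α * t + β)) *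
          expWeightNorm (fun ξ => 4 * ‖ξ + ν‖ ^ 2 / α ^ 2) (fourierHat (u 0)) ^
            (1 - β / (α * t + β))) := by
  have hm : ∀ s, AEStronglyMeasurable (u s : Rn n → ℂ) := fun s => Lp.aestronglyMeasurable _
  have hcont : ∀ (a : Rn n) (r : ℝ), Continuous fun x : Rn n => ‖x + a‖ ^ 2 / r ^ 2 :=
    fun a r => by fun_prop
  have hzero : (fun x : Rn n => ‖x‖ ^ 2 / β ^ 2) = fun x => ‖x + 0‖ ^ 2 / β ^ 2 := by simp
  have hnull : ∀ (s : ℝ) (a : Rn n) (r : ℝ), 0 ≤ s →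
      (expWeightNorm (fun x => ‖x + a‖ ^ 2 / r ^ 2) (u s) = 0 ↔ eLpNorm (u 0) 2 volume = 0) :=
    fun s a r hs => by rw [expWeightNorm_eq_zero_iff (hcont a r) (hm s), hu.eLpNorm_eq hs]
  refine ⟨fun T hT t ht htT => ?_, fun t ht => ?_⟩
  · have hrt : 0 < α * t + β := by positivity
    have hrT : 0 < α * T + β := by positivity
    set θ := β * (T - t) / (T * (α * t + β)) with hθdef
    have hθ1 : 1 - θ = t * (α * T + β) / (T * (α * t + β)) := by
      rw [hθdef]; field_simp; ring
    have hθ : θ ∈ Icc (0 : ℝ) 1 := by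
      refine ⟨div_nonneg (mul_nonneg hβ.le (sub_nonneg.2 htT)) (by positivity), ?_⟩
      have : 0 ≤ 1 - θ := by rw [hθ1]; positivity
      linarith
    rw [hzero]
    refine ENNReal.le_rpow_mul_rpow_of_finite hθ (fun hb hc => ?_) (fun h0 => ?_) (fun h1 => ?_)
      (fun hb => ?_) (fun hc => ?_)
    · have hd0 := superExpDecay_of_expWeightNorm_ne_top (hm 0) 0 hβ hb
      have hdT := superExpDecay_of_expWeightNorm_ne_top (hm T) _ hrT hc
      -- The slopes are p = 1/(αt+β), p₁ = 1/β and p₀ = 1/(αT+β). The identity tp = (1-θ)Tp₀ both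
      -- puts the point on the segment and matches the centres 2tν and 2Tν.
      refine expWeightNorm_gaussian_interp_le (hm t) (hm 0) (hm T) hθ ?_ fun v =>
        hu.expWeightNorm_inner_interp_le hd0 ht hT.le hdT hθ ?_ ?_ v
      · rw [smul_zero, smul_zero, zero_add, smul_smul, smul_smul, smul_smul, hθ1]
        congr 1
        field_simp
      · rw [hθ1, hθdef]; field_simp; ring
      · rw [hθ1]; field_simp
    · have htT' : t = T := by
        rw [hθdef, div_eq_zero_iff] at h0
        rcases h0 with h0 | h0
        · rcases mul_eq_zero.1 h0 with h0 | h0 <;> linarith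
        · exact absurd h0 (by positivity)
      rw [htT']
    · have ht0 : t = 0 := by
        rw [h1, sub_self, eq_comm, div_eq_zero_iff] at hθ1
        rcases hθ1 with h | h
        · exact (mul_eq_zero.1 h).resolve_right hrT.ne'
        · exact absurd h (by positivity)
      subst ht0
      simp
    · exact (hnull t _ _ ht).2 ((hnull 0 _ _ le_rfl).1 hb)
    · exact (hnull t _ _ ht).2 ((hnull T _ _ hT.le).1 hc)
  · have hrt : 0 < α * t + β := by positivity
    set θ := β / (α * t + β) with hθdef
    have hθ1 : 1 - θ = α * t / (α * t + β) := by
      rw [hθdef]; field_simp; ring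
    have hθ : θ ∈ Icc (0 : ℝ) 1 := by
      refine ⟨by positivity, ?_⟩
      have : 0 ≤ 1 - θ := by rw [hθ1]; positivity
      linarith
    -- The frequency weight has radius α/2, hence slope q = 2/α, and 2tp = (1-θ)q.
    have hfreq : (fun ξ : Rn n => 4 * ‖ξ + ν‖ ^ 2 / α ^ 2)
        = fun ξ => ‖ξ + ν‖ ^ 2 / (α / 2) ^ 2 := by
      ext ξ; field_simp; ring
    have hmF := aestronglyMeasurable_fourierHat (u 0)
    rw [hzero, hfreq]
    refine ENNReal.le_rpow_mul_rpow_of_finite hθ (fun hb hc => ?_) (fun h0 => ?_) (fun h1 => ?_)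
      (fun hb => ?_) (fun hc => ?_)
    · have hd0 := superExpDecay_of_expWeightNorm_ne_top (hm 0) 0 hβ hb
      have hdF := superExpDecay_of_expWeightNorm_ne_top hmF _ (half_pos hα) hc
      refine expWeightNorm_gaussian_interp_le (hm t) (hm 0) hmF hθ ?_ fun v =>
        hu.expWeightNorm_inner_interp_fourier_le hd0 ht hdF hθ ?_ ?_ v
      · rw [smul_zero, smul_zero, zero_add, smul_smul, smul_smul, hθ1]
        congr 1
        field_simp
      · rw [hθdef]; field_simp
      · rw [hθ1]; field_simp
    · exact absurd h0 (by positivity)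
    · have ht0 : t = 0 := by
        rw [h1, sub_self, eq_comm, div_eq_zero_iff] at hθ1
        rcases hθ1 with h | h
        · exact (mul_eq_zero.1 h).resolve_left hα.ne'
        · exact absurd h hrt.ne'
      subst ht0
      simp
    · exact (hnull t _ _ ht).2 ((hnull 0 _ _ le_rfl).1 hb)
    · rw [expWeightNorm_eq_zero_iff (hcont _ _) hmF, eLpNorm_fourierHat] at hc
      exact (hnull t _ _ ht).2 hc
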